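/- **Model.** Let $V(\rho,w)$ be a velocity function with flux $Q(\rho,w)=\rho V(\rho,w)$, for $w\in[w_L,w_R]$ and $\rho\in[0,\rho^{\max}(w)]$, where $\rho^{\max}(w)>0$. Assume that $V$ is $C^1$, $Q(\rho^{\max}(w),w)=0$, $\partial^2_{\rho}Q<0$, $\partial_wQ\ge 0$, $V\ge 0$, $\partial_\rho V<0$, $\partial_wV\ge 0$ on this set of states. Put $$C_*:=2\,\sup\Big(-\frac{\partial_wV(\rho,w)}{\partial_\rho V(\rho',w')}\Big)V(\rho'',w'),$$ the supremum being over all $w,w'\in[w_L,w_R]$, $\rho\in[0,\rho^{\max}(w)]$, $\rho',\rho''\in[0,\rho^{\max}(w')]$. **Waves.** A wave front $\Sigma=(U^-,U^+)$ has left and right states $U^\pm=(\rho^\pm,w^\pm)$. It is a $\rho$-wave if $w^-=w^+$ and $\rho^-\neq\rho^+$ (a shock with Rankine–Hugoniot speed if $\rho^-<\rho^+$, a rarefaction front with speed between the characteristic speeds $\partial_\rho Q(U^-)$ and $\partial_\rho Q(U^+)$ if $\rho^->\rho^+$). It is a $w$-wave if $w^-\ne w^+$ and $V(U^-)=V(U^+)$,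 and then it travels with this velocity. Its flux variations are $\delta_+Q_\Sigma=Q(U^+)-Q(U^-)$ and $\delta_-Q_\Sigma=-\delta_+Q_\Sigma$. On a road that ends (incoming road) or starts (outgoing road) at a junction $J$, consider a piecewise constant approximate solution constructed by wave-front tracking. Finitely many fronts start at time $0$. Two meeting $\rho$-waves $(U^-,U^*),(U^*,U^+)$ are replaced by the $\rho$-wave $(U^-,U^+)$ (or cancel if $U^-=U^+$). A $w$-wave that reaches a $\rho$-wave ahead of it is replaced, together with it, by a $\rho$-wave followed on its right by a $w$-wave. Fronts may leave the road at its ends, no front enters at the end away from $J$, and $J$ may at any time emit fronts of negative speed into an incoming road and of positive speed into an outgoing road. The *mothers* of a front generated by an interaction on the road are the interacting fronts. The *backward wave tree* of a front consists of this front, its mothers, their mothers, and so on; its *backward wave branch* is obtained by following only mothers of its own family. A *returning wave* $\Sigma^R$ with original time $t_o$ and absorption time $t_a>t_o$ is a $\rho$-wave that hits the junction at time $t_a$ and for which $t_o$ is the greatest time at which a wave of its backward wave branch was emitted from the junction. *Levels:* waves traveling at time $t_o$ (right after it) have level $1$. After $t_o$, the daughters of a $\rho$-wave of level $k$ and a $w$-wave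 have level $k+1$, and the daughter of two $\rho$-waves of levels $i,j$ has level $\max(i,j)$. The *order* $K$ of $\Sigma^R$ is the greatest level of a wave in its backward wave tree. There is a sequence of successive mothers and daughters among $\rho$-waves, from a level-$1$ wave traveling at time $t_o$ to $\Sigma^R$, that passes through all levels $1,\dots,K$ and goes up one level exactly at its interactions with $w$-waves. For any such sequence let $w^k$ be the value of $w$ on its waves of level $k$, and put $$TV^K_{tree}:=\sum_{k=2}^K|w^k-w^{k-1}|.$$ **Proposition.** The constant $C_*$ is finite and nonnegative, and $C_*>0$ unless $\partial_wV\equiv0$. Let $\Sigma^R$ be a returning wave of order $K$ on an incoming or an outgoing road, and let $\Sigma_1,\dots,\Sigma_N$ be the $\rho$-waves of level $1$ at the original time $t_o$ in its backward wave tree. Then $$\delta_+Q_{\Sigma^R}\le C_*\,TV^K_{tree}+\sum_{r=1}^{N}[\delta_+Q_{\Sigma_r}]_+\qquad\text{and}\qquad \delta_-Q_{\Sigma^R}\le C_*\,TV^K_{tree}+\sum_{r=1}^{N}[\delta_-Q_{\Sigma_r}]_+,$$ where $[\cdot]_+$ denotes the positive part; one of these two quantities is the flux variation of $\Sigma^R$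 at the absorption time ($\delta_-$ on an incoming road, $\delta_+$ on an outgoing road). -/

import Mathlib

open Set

/-- The flux `Q(ρ, w) = ρ V(ρ, w)` of a velocity function. -/
def fluxOf (V : ℝ → ℝ → ℝ) (r w : ℝ) : ℝ := r * V r w

/-- A generic second order traffic model: a velocity function `V(ρ, w)`, the range `[wL, wR]` of the
driver property and the maximal densities `ρmax(w)`, subject to the standing assumptions on
`Q = ρ V` and `V`, which are imposed at the physical states `w ∈ [wL, wR]`, `ρ ∈ [0, ρmax(w)]`. -/
structure GSOM where
  V : ℝ → ℝ → ℝ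
  wL : ℝ
  wR : ℝ
  wL_le_wR : wL ≤ wR
  rhoMax : ℝ → ℝ
  rhoMax_pos : ∀ w ∈ Icc wL wR, 0 < rhoMax w
  contDiffAt_V : ∀ w ∈ Icc wL wR, ∀ r ∈ Icc 0 (rhoMax w),
    ContDiffAt ℝ 1 (fun p : ℝ × ℝ => V p.1 p.2) (r, w)
  /-- `Q(ρmax(w), w) = 0` (while `Q(0, w) = 0` holds by the form of `Q`) -/
  flux_rhoMax : ∀ w ∈ Icc wL wR, fluxOf V (rhoMax w) w = 0
  /-- `∂²Q/∂ρ² < 0` -/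
  flux_concave : ∀ w ∈ Icc wL wR, ∀ r ∈ Icc 0 (rhoMax w),
    deriv (deriv (fun s => fluxOf V s w)) r < 0
  /-- `∂Q/∂w ≥ 0` -/
  flux_mono : ∀ w ∈ Icc wL wR, ∀ r ∈ Icc 0 (rhoMax w), 0 ≤ deriv (fun u => fluxOf V r u) w
  V_nonneg : ∀ w ∈ Icc wL wR, ∀ r ∈ Icc 0 (rhoMax w), 0 ≤ V r w
  /-- `∂V/∂ρ < 0` -/
  V_anti : ∀ w ∈ Icc wL wR, ∀ r ∈ Icc 0 (rhoMax w), deriv (fun s => V s w) r < 0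
  /-- `∂V/∂w ≥ 0` -/
  V_mono : ∀ w ∈ Icc wL wR, ∀ r ∈ Icc 0 (rhoMax w), 0 ≤ deriv (fun u => V r u) w

/-- A state `U = (ρ, w)`. -/
@[ext] structure TrafficState where
  rho : ℝ
  w : ℝ

/-- The two families of waves. -/
inductive WaveFamily
  | rho
  | w

/-- A wave front: its family, its left and right state, the time and place where it is generated, and
its speed. -/
structure WaveFront where
  family : WaveFamily
  left : TrafficState
  right : TrafficState
  birthTime : ℝ
  birthPlace : ℝ
  speed : ℝ

/-- The position of a front at time `t`. -/
def WaveFront.pos (f : WaveFront) (t : ℝ) : ℝ := f.birthPlace + f.speed * (t - f.birthTime)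

namespace GSOM

variable (M : GSOM)

/-- The physical states. -/
def Physical (U : TrafficState) : Prop :=
  U.w ∈ Icc M.wL M.wR ∧ U.rho ∈ Icc 0 (M.rhoMax U.w)

/-- The flux `Q` at a state. -/
def Q (U : TrafficState) : ℝ := fluxOf M.V U.rho U.w

/-- The velocity at a state. -/
def vel (U : TrafficState) : ℝ := M.V U.rho U.w

/-- The partial derivative `∂V/∂ρ` at a state. -/
noncomputable def Vrho (U : TrafficState) : ℝ := deriv (fun s => M.V s U.w) U.rho

/-- The partial derivative `∂V/∂w` at a state. -/
noncomputable def Vw (U : TrafficState) : ℝ := deriv (fun u => M.V U.rho u) U.w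

/-- The first characteristic speed `λ₁ = V + ρ ∂V/∂ρ`. -/
noncomputable def charSpeed (U : TrafficState) : ℝ := M.vel U + U.rho * M.Vrho U

/-- The numbers over which the supremum in the constant `C_*` is taken. -/
def ratios : Set ℝ :=
  {c | ∃ U U' U'' : TrafficState, M.Physical U ∧ M.Physical U' ∧ M.Physical U'' ∧ U''.w = U'.w ∧
    c = -(M.Vw U / M.Vrho U') * M.vel U''}

/-- `C_* = 2 sup (- ∂_w V(ρ, w) / ∂_ρ V(ρ', w')) V(ρ'', w')`. -/
noncomputable def Cstar : ℝ := 2 * sSup M.ratios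

/-- `(U⁻, U⁺)` is a `ρ`-wave: `w` is conserved and `ρ` jumps. A shock (`ρ⁻ < ρ⁺`) has the
Rankine-Hugoniot speed. A rarefaction front (`ρ⁻ > ρ⁺`) has a speed between the characteristic speeds
of its two states; this covers the usual choices in wave-front tracking. -/
def IsRhoWave (f : WaveFront) : Prop :=
  f.left.w = f.right.w ∧
    ((f.left.rho < f.right.rho ∧
        f.speed = (M.Q f.right - M.Q f.left) / (f.right.rho - f.left.rho)) ∨
      (f.right.rho < f.left.rho ∧
        f.speed ∈ Icc (M.charSpeed f.left) (M.charSpeed f.right)))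

/-- `(U⁻, U⁺)` is a `w`-wave (contact discontinuity): `w` jumps, the velocity is conserved, and the
front travels with this velocity. -/
def IsWWave (f : WaveFront) : Prop :=
  f.left.w ≠ f.right.w ∧ M.vel f.left = M.vel f.right ∧ f.speed = M.vel f.right

/-- An elementary wave front between physical states. -/
def IsWave (f : WaveFront) : Prop :=
  M.Physical f.left ∧ M.Physical f.right ∧
    match f.family with
    | WaveFamily.rho => M.IsRhoWave f
    | WaveFamily.w => M.IsWWave f

/-- The forward flux variation `δ₊Q = Q(U⁺) - Q(U⁻)` across a front. -/
def deltaPlus (f : WaveFront) : ℝ := M.Q f.right - M.Q f.left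

/-- The backward flux variation `δ₋Q = -δ₊Q` across a front. -/
def deltaMinus (f : WaveFront) : ℝ := -M.deltaPlus f

end GSOM

/-- The two kinds of roads at a junction. -/
inductive RoadKind
  | incoming
  | outgoing

/-- A road at a junction located at `J`: an interval `[far, J]` for an incoming road and `[J, far]`
for an outgoing one. The far end may be infinite. -/
structure Road where
  kind : RoadKind
  J : ℝ
  far : EReal
  far_lt : kind = RoadKind.incoming → far < (J : EReal)
  lt_far : kind = RoadKind.outgoing → (J : EReal) < far

namespace Road

/-- The left end of the road. -/
noncomputable def leftEnd (I : Road) : EReal :=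
  match I.kind with
  | RoadKind.incoming => I.far
  | RoadKind.outgoing => (I.J : EReal)

/-- The right end of the road. -/
noncomputable def rightEnd (I : Road) : EReal :=
  match I.kind with
  | RoadKind.incoming => (I.J : EReal)
  | RoadKind.outgoing => I.far

/-- `x` lies in the road, ends included. -/
def Contains (I : Road) (x : ℝ) : Prop := I.leftEnd ≤ (x : EReal) ∧ (x : EReal) ≤ I.rightEnd

/-- `x` lies in the interior of the road. -/
def Inside (I : Road) (x : ℝ) : Prop := I.leftEnd < (x : EReal) ∧ (x : EReal) < I.rightEnd

end Road

/-- `IsProfile front U L U'`: reading the fronts with labels `L` from left to right, one passes from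
the state `U` at the left end of the road to the state `U'` at its right end. -/
def IsProfile (front : ℕ → WaveFront) : TrafficState → List ℕ → TrafficState → Prop
  | U, [], U' => U = U'
  | U, f :: L, U' => (front f).left = U ∧ IsProfile front (front f).right L U'

/-- The situation on a road between two events: the state at the left end, the labels of the fronts
from left to right, and the state at the right end. -/
structure RoadSnapshot where
  left : TrafficState
  fronts : List ℕ
  right : TrafficState

/-- A single event of the wave-front tracking algorithm on the road `I` at time `t`: the snapshots
before and after it. -/
inductive TrackingEvent (front : ℕ → WaveFront) (I : Road) (t : ℝ) :
    RoadSnapshot → RoadSnapshot → Prop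
  /-- nothing happens on this road -/
  | idle (P : RoadSnapshot) : TrackingEvent front I t P P
  /-- two `ρ`-waves `(U⁻, U*)`, `(U*, U⁺)` meet and generate the `ρ`-wave `(U⁻, U⁺)` -/
  | merge (U U' : TrafficState) (A B : List ℕ) (l r g : ℕ)
      (hl : (front l).family = WaveFamily.rho) (hr : (front r).family = WaveFamily.rho)
      (hg : (front g).family = WaveFamily.rho)
      (hmeet : (front l).pos t = (front r).pos t) (hspeed : (front r).speed < (front l).speed)
      (hin : I.Inside ((front l).pos t))
      (htime : (front g).birthTime = t) (hplace : (front g).birthPlace = (front l).pos t) :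
      TrackingEvent front I t ⟨U, A ++ l :: r :: B, U'⟩ ⟨U, A ++ g :: B, U'⟩
  /-- two `ρ`-waves `(U⁻, U*)`, `(U*, U⁻)` meet and cancel each other -/
  | cancel (U U' : TrafficState) (A B : List ℕ) (l r : ℕ)
      (hl : (front l).family = WaveFamily.rho) (hr : (front r).family = WaveFamily.rho)
      (hmeet : (front l).pos t = (front r).pos t) (hspeed : (front r).speed < (front l).speed)
      (hin : I.Inside ((front l).pos t)) :
      TrackingEvent front I t ⟨U, A ++ l :: r :: B, U'⟩ ⟨U, A ++ B, U'⟩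
  /-- a `w`-wave reaches a `ρ`-wave ahead of it; they generate a `ρ`-wave and, on its right, a
  `w`-wave -/
  | cross (U U' : TrafficState) (A B : List ℕ) (c r g c' : ℕ)
      (hc : (front c).family = WaveFamily.w) (hr : (front r).family = WaveFamily.rho)
      (hg : (front g).family = WaveFamily.rho) (hc' : (front c').family = WaveFamily.w)
      (hmeet : (front c).pos t = (front r).pos t) (hspeed : (front r).speed < (front c).speed)
      (hin : I.Inside ((front c).pos t))
      (htime : (front g).birthTime = t) (hplace : (front g).birthPlace = (front c).pos t)
      (htime' : (front c').birthTime = t) (hplace' : (front c').birthPlace = (front c).pos t) :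
      TrackingEvent front I t ⟨U, A ++ c :: r :: B, U'⟩ ⟨U, A ++ g :: c' :: B, U'⟩
  /-- a front leaves the road at its right end -/
  | leaveRight (U U' : TrafficState) (A : List ℕ) (f : ℕ)
      (hpos : ((front f).pos t : EReal) = I.rightEnd) (hspeed : 0 < (front f).speed) :
      TrackingEvent front I t ⟨U, A ++ [f], U'⟩ ⟨U, A, (front f).left⟩
  /-- a front leaves the road at its left end -/
  | leaveLeft (U U' : TrafficState) (B : List ℕ) (f : ℕ)
      (hpos : ((front f).pos t : EReal) = I.leftEnd) (hspeed : (front f).speed < 0) :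
      TrackingEvent front I t ⟨U, f :: B, U'⟩ ⟨(front f).right, B, U'⟩
  /-- the junction emits waves of negative speed into an incoming road -/
  | emitIncoming (U U' U'' : TrafficState) (A N : List ℕ) (hI : I.kind = RoadKind.incoming)
      (hN : ∀ f ∈ N, (front f).birthTime = t ∧ (front f).birthPlace = I.J ∧ (front f).speed < 0) :
      TrackingEvent front I t ⟨U, A, U'⟩ ⟨U, A ++ N, U''⟩
  /-- the junction emits waves of positive speed into an outgoing road -/
  | emitOutgoing (U U' U'' : TrafficState) (N B : List ℕ) (hI : I.kind = RoadKind.outgoing)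
      (hN : ∀ f ∈ N, (front f).birthTime = t ∧ (front f).birthPlace = I.J ∧ 0 < (front f).speed) :
      TrackingEvent front I t ⟨U, B, U'⟩ ⟨U'', N ++ B, U'⟩

/-- A piecewise constant approximate solution on the road `I`, constructed by wave-front tracking.
Its fronts carry labels; `snap n` describes the road between the event times `time n` and
`time (n + 1)`. Simultaneous events are executed one after the other, with equal event times. -/
structure FrontTracking (M : GSOM) (I : Road) where
  front : ℕ → WaveFront
  time : ℕ → ℝ
  snap : ℕ → RoadSnapshot
  time_zero : time 0 = 0
  time_mono : Monotone time
  physical : ∀ n, M.Physical (snap n).left ∧ M.Physical (snap n).right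
  isWave : ∀ n, ∀ f ∈ (snap n).fronts, M.IsWave (front f)
  nodup : ∀ n, (snap n).fronts.Nodup
  birthTime_zero : ∀ f ∈ (snap 0).fronts, (front f).birthTime = 0
  profile : ∀ n, IsProfile front (snap n).left (snap n).fronts (snap n).right
  contained : ∀ n, ∀ t ∈ Icc (time n) (time (n + 1)), ∀ f ∈ (snap n).fronts,
    I.Contains ((front f).pos t)
  ordered : ∀ n, ∀ t ∈ Icc (time n) (time (n + 1)),
    (snap n).fronts.Pairwise (fun f g => (front f).pos t ≤ (front g).pos t)
  event : ∀ n, TrackingEvent front I (time (n + 1)) (snap n) (snap (n + 1))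
  /-- a new front has a label that was not in use before -/
  fresh : ∀ n, ∀ g ∈ (snap (n + 1)).fronts, g ∉ (snap n).fronts → ∀ m ≤ n, g ∉ (snap m).fronts

namespace FrontTracking

variable {M : GSOM} {I : Road} (S : FrontTracking M I)

/-- `f` is a mother of `g`: in one and the same event `f` disappears and `g` is generated. This
happens only when waves interact inside the road. -/
def Mother (f g : ℕ) : Prop :=
  ∃ n, f ∈ (S.snap n).fronts ∧ f ∉ (S.snap (n + 1)).fronts ∧
    g ∉ (S.snap n).fronts ∧ g ∈ (S.snap (n + 1)).fronts

/-- `f` belongs to the backward wave tree of `g`: fronts of both families are traced back. -/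
def InTree (g f : ℕ) : Prop := Relation.ReflTransGen S.Mother f g

/-- `f` belongs to the backward wave branch of `g`: only fronts of the family of `g` are traced
back. -/
def InBranch (g f : ℕ) : Prop :=
  Relation.ReflTransGen
    (fun a b => S.Mother a b ∧ (S.front a).family = (S.front b).family) f g

/-- The front `f` is traveling on the road at time `t` (right after the events at time `t`). -/
def TravelsAt (t : ℝ) (f : ℕ) : Prop :=
  ∃ n, S.time n ≤ t ∧ t < S.time (n + 1) ∧ f ∈ (S.snap n).fronts

/-- The front `f` interacts with the junction at time `t`. -/
def AbsorbedAt (f : ℕ) (t : ℝ) : Prop :=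
  ∃ n, S.time (n + 1) = t ∧ f ∈ (S.snap n).fronts ∧ f ∉ (S.snap (n + 1)).fronts ∧
    (S.front f).pos t = I.J

/-- `R` is a returning wave with original time `tO` and absorption time `ta`: a `ρ`-wave that
interacts with the junction at time `ta`, and `tO < ta` is the greatest time at which a wave of its
backward wave branch originated from the junction. -/
def IsReturningWave (R : ℕ) (tO ta : ℝ) : Prop :=
  (S.front R).family = WaveFamily.rho ∧ S.AbsorbedAt R ta ∧ tO < ta ∧
    IsGreatest {t | ∃ f, S.InBranch R f ∧ (S.front f).birthPlace = I.J ∧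
      (S.front f).birthTime = t} tO

/-- The level of waves, counted from the time `tO`. -/
inductive Level (tO : ℝ) : ℕ → ℕ → Prop
  /-- the waves traveling at time `tO` have level `1` -/
  | base (f : ℕ) (hf : S.TravelsAt tO f) : Level tO f 1
  /-- an interaction of two `ρ`-waves does not raise the level -/
  | merge (l r g i j : ℕ) (hlr : l ≠ r) (hl : S.Mother l g) (hr : S.Mother r g)
      (hlf : (S.front l).family = WaveFamily.rho) (hrf : (S.front r).family = WaveFamily.rho)
      (hg : tO < (S.front g).birthTime) (hi : Level tO l i) (hj : Level tO r j) :
      Level tO g (max i j)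
  /-- an interaction of a `ρ`-wave of level `k` with a `w`-wave generates waves of level `k + 1` -/
  | cross (c r g k : ℕ) (hc : S.Mother c g) (hr : S.Mother r g)
      (hcf : (S.front c).family = WaveFamily.w) (hrf : (S.front r).family = WaveFamily.rho)
      (hg : tO < (S.front g).birthTime) (hk : Level tO r k) : Level tO g (k + 1)

/-- `R` has order `K`: the greatest level of a wave in its backward wave tree is `K`. -/
def HasOrder (tO : ℝ) (R K : ℕ) : Prop :=
  IsGreatest {k | ∃ f, S.InTree R f ∧ S.Level tO f k} K

/-- `IsLevelBranch tO om f k`: some sequence of `ρ`-waves of the backward wave branch of `f` leads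
from a wave of level `1` traveling at time `tO` to the wave `f` of level `k`, runs through all levels
`1, …, k`, goes up a level exactly when it interacts with a `w`-wave, and has the value `om i` of the
property `w` on level `i`. -/
inductive IsLevelBranch (tO : ℝ) (om : ℕ → ℝ) : ℕ → ℕ → Prop
  | base (f : ℕ) (hf : S.TravelsAt tO f) (hff : (S.front f).family = WaveFamily.rho)
      (hom : om 1 = (S.front f).right.w) : IsLevelBranch tO om f 1
  | merge (l r g k : ℕ) (hlr : l ≠ r) (hl : S.Mother l g) (hr : S.Mother r g)
      (hlf : (S.front l).family = WaveFamily.rho) (hrf : (S.front r).family = WaveFamily.rho)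
      (hg : tO < (S.front g).birthTime) (hk : IsLevelBranch tO om l k) (hgk : S.Level tO g k) :
      IsLevelBranch tO om g k
  | cross (c r g k : ℕ) (hc : S.Mother c g) (hr : S.Mother r g)
      (hcf : (S.front c).family = WaveFamily.w) (hrf : (S.front r).family = WaveFamily.rho)
      (hgf : (S.front g).family = WaveFamily.rho)
      (hg : tO < (S.front g).birthTime) (hk : IsLevelBranch tO om r k)
      (hom : om (k + 1) = (S.front g).right.w) : IsLevelBranch tO om g (k + 1)

/-- The `ρ`-waves of level `1` at time `tO` in the backward wave tree of `R`. -/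
def levelOne (tO : ℝ) (R : ℕ) : Set ℕ :=
  {f | S.InTree R f ∧ (S.front f).family = WaveFamily.rho ∧ S.TravelsAt tO f}

/-- There are finitely many waves of level `1`. -/
theorem levelOne_finite (tO : ℝ) (R : ℕ) : (S.levelOne tO R).Finite := by
  by_cases h : ∃ n, S.time n ≤ tO ∧ tO < S.time (n + 1)
  · obtain ⟨n, h1, h2⟩ := h
    refine Set.Finite.subset (List.finite_toSet (S.snap n).fronts) ?_
    rintro f ⟨-, -, m, h3, h4, h5⟩
    have hmn : m = n := by
      by_contra hne
      rcases Nat.lt_or_gt_of_ne hne with hlt | hlt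
      · have := S.time_mono (show m + 1 ≤ n from hlt)
        linarith
      · have := S.time_mono (show n + 1 ≤ m from hlt)
        linarith
    subst hmn
    exact h5
  · refine Set.Finite.subset Set.finite_empty ?_
    rintro f ⟨-, -, m, h3, h4, -⟩
    exact h ⟨m, h3, h4⟩

end FrontTracking

/-- The `w`-variation `∑_{k=2}^K |w^k - w^{k-1}|` along `K` levels. -/
def levelVariation (om : ℕ → ℝ) (K : ℕ) : ℝ :=
  ∑ k ∈ Finset.Icc 2 K, |om k - om (k - 1)|

namespace GSOM

open Filter Topology

variable (M : GSOM)

theorem hasFDerivAt_V {U : TrafficState} (hU : M.Physical U) :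
    HasFDerivAt (fun p : ℝ × ℝ => M.V p.1 p.2)
      (fderiv ℝ (fun p : ℝ × ℝ => M.V p.1 p.2) (U.rho, U.w)) (U.rho, U.w) :=
  ((M.contDiffAt_V U.w hU.1 U.rho hU.2).differentiableAt one_ne_zero).hasFDerivAt

theorem hasDerivAt_V_rho {U : TrafficState} (hU : M.Physical U) :
    HasDerivAt (fun s => M.V s U.w) (fderiv ℝ (fun p : ℝ × ℝ => M.V p.1 p.2) (U.rho, U.w) (1, 0))
      U.rho :=
  (M.hasFDerivAt_V hU).comp_hasDerivAt_of_eq U.rho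
    ((hasDerivAt_id U.rho).prodMk (hasDerivAt_const U.rho U.w)) rfl

theorem hasDerivAt_V_w {U : TrafficState} (hU : M.Physical U) :
    HasDerivAt (fun u => M.V U.rho u) (fderiv ℝ (fun p : ℝ × ℝ => M.V p.1 p.2) (U.rho, U.w) (0, 1))
      U.w :=
  (M.hasFDerivAt_V hU).comp_hasDerivAt_of_eq U.w
    ((hasDerivAt_const U.w U.rho).prodMk (hasDerivAt_id U.w)) rfl

theorem Vrho_eq_fderiv {U : TrafficState} (hU : M.Physical U) :
    M.Vrho U = fderiv ℝ (fun p : ℝ × ℝ => M.V p.1 p.2) (U.rho, U.w) (1, 0) :=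
  (M.hasDerivAt_V_rho hU).deriv

theorem Vw_eq_fderiv {U : TrafficState} (hU : M.Physical U) :
    M.Vw U = fderiv ℝ (fun p : ℝ × ℝ => M.V p.1 p.2) (U.rho, U.w) (0, 1) :=
  (M.hasDerivAt_V_w hU).deriv

theorem Vrho_neg {U : TrafficState} (hU : M.Physical U) : M.Vrho U < 0 :=
  M.V_anti U.w hU.1 U.rho hU.2

theorem Vw_nonneg {U : TrafficState} (hU : M.Physical U) : 0 ≤ M.Vw U :=
  M.V_mono U.w hU.1 U.rho hU.2

theorem vel_nonneg {U : TrafficState} (hU : M.Physical U) : 0 ≤ M.vel U :=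
  M.V_nonneg U.w hU.1 U.rho hU.2

theorem physical_zero {w : ℝ} (hw : w ∈ Icc M.wL M.wR) : M.Physical ⟨0, w⟩ :=
  ⟨hw, left_mem_Icc.2 (M.rhoMax_pos w hw).le⟩

theorem physical_rhoMax {w : ℝ} (hw : w ∈ Icc M.wL M.wR) : M.Physical ⟨M.rhoMax w, w⟩ :=
  ⟨hw, right_mem_Icc.2 (M.rhoMax_pos w hw).le⟩

theorem V_rhoMax {w : ℝ} (hw : w ∈ Icc M.wL M.wR) : M.V (M.rhoMax w) w = 0 :=
  (mul_eq_zero.1 (M.flux_rhoMax w hw)).resolve_left (M.rhoMax_pos w hw).ne'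

theorem continuousOn_V {w : ℝ} (hw : w ∈ Icc M.wL M.wR) :
    ContinuousOn (fun r => M.V r w) (Icc 0 (M.rhoMax w)) := fun r hr =>
  (M.hasDerivAt_V_rho (U := ⟨r, w⟩) ⟨hw, hr⟩).continuousAt.continuousWithinAt

theorem strictAntiOn_V {w : ℝ} (hw : w ∈ Icc M.wL M.wR) :
    StrictAntiOn (fun r => M.V r w) (Icc 0 (M.rhoMax w)) :=
  strictAntiOn_of_deriv_neg (convex_Icc _ _) (M.continuousOn_V hw)
    fun r hr => M.V_anti w hw r (interior_subset hr)

theorem monotoneOn_V_zero : MonotoneOn (fun w => M.V 0 w) (Icc M.wL M.wR) := by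
  have key : ∀ w ∈ Icc M.wL M.wR, HasDerivAt (fun w => M.V 0 w) (deriv (fun w => M.V 0 w) w) w :=
    fun w hw => (M.hasDerivAt_V_w (M.physical_zero hw)).differentiableAt.hasDerivAt
  refine monotoneOn_of_deriv_nonneg (convex_Icc _ _)
    (fun w hw => (key w hw).continuousAt.continuousWithinAt)
    (fun w hw => (key w (interior_subset hw)).differentiableAt.differentiableWithinAt)
    fun w hw => ?_
  have hw := interior_subset hw
  exact M.V_mono w hw 0 (M.physical_zero hw).2

/-- A curve of constant velocity in the set of physical states is continuous. -/
theorem continuousWithinAt_of_vel_eq {s : Set ℝ} {v : ℝ} {r : ℝ → ℝ}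
    (hr : ∀ w ∈ s, M.Physical ⟨r w, w⟩ ∧ M.V (r w) w = v) {w₀ : ℝ} (hw₀ : w₀ ∈ s) :
    ContinuousWithinAt r s w₀ := by
  have hcont : ∀ x ∈ Icc 0 (M.rhoMax w₀),
      ContinuousAt (fun p : ℝ × ℝ => M.V p.2 p.1) (w₀, x) := fun x hx =>
    ((M.contDiffAt_V w₀ (hr w₀ hw₀).1.1 x hx).continuousAt).comp
      (f := fun p : ℝ × ℝ => (p.2, p.1)) (x := (w₀, x)) (by fun_prop)
  obtain ⟨⟨hw, h0, h1⟩, hv⟩ := hr w₀ hw₀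
  have hanti := M.strictAntiOn_V hw
  dsimp only at h0 h1 hw
  refine tendsto_order.2 ⟨fun a ha => ?_, fun b hb => ?_⟩
  · have hK : ∀ᶠ w in 𝓝 w₀, ∀ x ∈ Icc 0 a, v < M.V x w := by
      refine isCompact_Icc.eventually_forall_of_forall_eventually fun x hx => ?_
      have hx' : x ∈ Icc 0 (M.rhoMax w₀) := ⟨hx.1, hx.2.trans (ha.le.trans h1)⟩
      refine (hcont x hx').eventually_const_lt ?_
      rw [← hv]
      exact hanti hx' ⟨h0, h1⟩ (hx.2.trans_lt ha)
    filter_upwards [nhdsWithin_le_nhds hK, self_mem_nhdsWithin] with w h hws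
    by_contra! hle
    have := h (r w) ⟨(hr w hws).1.2.1, hle⟩
    exact this.ne' (hr w hws).2
  · obtain ⟨b', hb', hb0, hVb⟩ : ∃ b', b' ≤ b ∧ r w₀ < b' ∧ ∀ᶠ w in 𝓝 w₀, M.V b' w < v := by
      have hneg := M.Vrho_neg (hr w₀ hw₀).1
      have hd : HasDerivAt (fun x => M.V x w₀) (M.Vrho ⟨r w₀, w₀⟩) (r w₀) := by
        rw [M.Vrho_eq_fderiv (hr w₀ hw₀).1]; exact M.hasDerivAt_V_rho (hr w₀ hw₀).1
      have h2 : ∀ᶠ x in 𝓝[>] (r w₀), M.V x w₀ < v := by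
        have := (hasDerivWithinAt_iff_tendsto_slope' (notMem_Ioi.2 le_rfl)).1
          (hd.hasDerivWithinAt (s := Ioi (r w₀)))
        filter_upwards [this.eventually_lt_const hneg, self_mem_nhdsWithin] with x hx hx0
        rw [slope_def_field] at hx
        have := (div_neg_iff.1 hx).resolve_left (fun h => absurd h.2 (by simp at hx0; linarith))
        linarith [this.1]
      have h3 : ∀ᶠ x in 𝓝[>] (r w₀), ContDiffAt ℝ 1 (fun p : ℝ × ℝ => M.V p.1 p.2) (x, w₀) := by
        have := (M.contDiffAt_V w₀ hw (r w₀) ⟨h0, h1⟩).eventually (by simp)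
        have hc : Tendsto (fun x : ℝ => (x, w₀)) (𝓝[>] (r w₀)) (𝓝 (r w₀, w₀)) :=
          (Continuous.tendsto (by fun_prop) _).mono_left nhdsWithin_le_nhds
        exact hc.eventually this
      obtain ⟨x, hx, hxd, hxb⟩ := (h2.and (h3.and (Ioc_mem_nhdsGT hb))).exists
      refine ⟨x, hxb.2, hxb.1, ?_⟩
      have : ContinuousAt (fun w => M.V x w) w₀ :=
        hxd.continuousAt.comp (f := fun w : ℝ => (x, w)) (x := w₀) (by fun_prop)
      exact this.eventually_lt_const hx
    filter_upwards [nhdsWithin_le_nhds hVb, self_mem_nhdsWithin] with w h hws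
    by_contra! hle
    obtain ⟨⟨hwp, hw0, hw1⟩, hwv⟩ := hr w hws
    have := (M.strictAntiOn_V hwp).antitoneOn ⟨h0.trans hb0.le, hb'.trans (hle.trans hw1)⟩
      ⟨hw0, hw1⟩ (hb'.trans hle)
    dsimp only at this
    linarith

/-- The slope of a curve of constant velocity in the set of physical states. -/
theorem hasDerivWithinAt_of_vel_eq {s : Set ℝ} {v : ℝ} {r : ℝ → ℝ}
    (hr : ∀ w ∈ s, M.Physical ⟨r w, w⟩ ∧ M.V (r w) w = v) {w₀ : ℝ} (hw₀ : w₀ ∈ s) :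
    HasDerivWithinAt r (-(M.Vw ⟨r w₀, w₀⟩ / M.Vrho ⟨r w₀, w₀⟩)) s w₀ := by
  have hp := (hr w₀ hw₀).1
  have hneg := M.Vrho_neg hp
  set f' := fderiv ℝ (fun p : ℝ × ℝ => M.V p.1 p.2) (r w₀, w₀) with hf'
  have hV : HasStrictFDerivAt (fun p : ℝ × ℝ => M.V p.2 p.1)
      (f' ∘L ((ContinuousLinearMap.snd ℝ ℝ ℝ).prod (ContinuousLinearMap.fst ℝ ℝ ℝ)))
      (w₀, r w₀) :=
    ((M.contDiffAt_V w₀ hp.1 (r w₀) hp.2).hasStrictFDerivAt one_ne_zero).comp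
      (f := fun p : ℝ × ℝ => (p.2, p.1)) (w₀, r w₀)
      (hasStrictFDerivAt_snd.prodMk hasStrictFDerivAt_fst)
  set F := f' ∘L ((ContinuousLinearMap.snd ℝ ℝ ℝ).prod (ContinuousLinearMap.fst ℝ ℝ ℝ)) with hF
  have hF1 : (F ∘L .inr ℝ ℝ ℝ) 1 = M.Vrho ⟨r w₀, w₀⟩ := by
    simp [hF, hf', M.Vrho_eq_fderiv hp]
  have hF2 : (F ∘L .inl ℝ ℝ ℝ) 1 = M.Vw ⟨r w₀, w₀⟩ := by
    simp [hF, hf', M.Vw_eq_fderiv hp]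
  have hinv : (F ∘L .inr ℝ ℝ ℝ).IsInvertible := by
    refine ⟨ContinuousLinearEquiv.unitsEquivAut ℝ (Units.mk0 _ hneg.ne), ?_⟩
    ext
    simpa using hF1.symm
  have hψ := hV.hasStrictFDerivAt_implicitFunctionOfProdDomain hinv
  set ψ := hV.implicitFunctionOfProdDomain hinv
  have hev : r =ᶠ[𝓝[s] w₀] ψ := by
    have ht : Tendsto (fun w => (w, r w)) (𝓝[s] w₀) (𝓝 (w₀, r w₀)) :=
      (tendsto_id.mono_left nhdsWithin_le_nhds).prodMk_nhds (M.continuousWithinAt_of_vel_eq hr hw₀)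
    filter_upwards [ht.eventually (hV.eventually_apply_eq_iff_implicitFunctionOfProdDomain hinv),
      self_mem_nhdsWithin] with w h hws
    exact (h.1 ((hr w hws).2.trans (hr w₀ hw₀).2.symm)).symm
  have hd := (hψ.hasFDerivAt.hasDerivAt.hasDerivWithinAt (s := s)).congr_of_eventuallyEq_of_mem
    hev hw₀
  set d := (F ∘L .inr ℝ ℝ ℝ).inverse ((F ∘L .inl ℝ ℝ ℝ) 1) with hdd
  have h1 : (F ∘L .inr ℝ ℝ ℝ) d = M.Vw ⟨r w₀, w₀⟩ := by
    rw [← hF2, hdd]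
    obtain ⟨e, he⟩ := hinv
    rw [← he, ContinuousLinearMap.inverse_equiv]
    simp
  have h2 : (F ∘L .inr ℝ ℝ ℝ) d = d * M.Vrho ⟨r w₀, w₀⟩ := by
    rw [← hF1, ← smul_eq_mul, ← map_smul]; simp
  have : M.Vw ⟨r w₀, w₀⟩ / M.Vrho ⟨r w₀, w₀⟩ = d := by
    rw [← h1, h2, mul_div_cancel_right₀ _ hneg.ne]
  rw [this]
  exact hd

theorem continuousOn_rhoMax : ContinuousOn M.rhoMax (Icc M.wL M.wR) := fun _ hw =>
  M.continuousWithinAt_of_vel_eq (v := 0)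
    (fun _ hw => ⟨M.physical_rhoMax hw, M.V_rhoMax hw⟩) hw

theorem isCompact_physical :
    IsCompact {p : ℝ × ℝ | M.Physical ⟨p.1, p.2⟩} := by
  have h : {p : ℝ × ℝ | M.Physical ⟨p.1, p.2⟩} =
      (fun q : ℝ × ℝ => (q.1 * M.rhoMax q.2, q.2)) '' (Icc 0 1 ×ˢ Icc M.wL M.wR) := by
    ext ⟨r, w⟩
    simp only [Set.mem_ofPred_eq, Set.mem_image, Set.mem_prod, Prod.exists, Prod.mk.injEq]
    constructor
    · rintro ⟨hw, h0, h1⟩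
      have hpos := M.rhoMax_pos w hw
      exact ⟨r / M.rhoMax w, w, ⟨⟨div_nonneg h0 hpos.le, (div_le_one hpos).2 h1⟩, hw⟩,
        div_mul_cancel₀ _ hpos.ne', rfl⟩
    · rintro ⟨t, w', ⟨ht, hw⟩, rfl, rfl⟩
      have hpos := M.rhoMax_pos w' hw
      exact ⟨hw, mul_nonneg ht.1 hpos.le, mul_le_of_le_one_left hpos.le ht.2⟩
  rw [h]
  refine (isCompact_Icc.prod isCompact_Icc).image_of_continuousOn ?_
  have := M.continuousOn_rhoMax.comp continuousOn_snd
    (fun q (hq : q ∈ Icc (0 : ℝ) 1 ×ˢ Icc M.wL M.wR) => hq.2)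
  exact (continuousOn_fst.mul this).prodMk continuousOn_snd

theorem bddAbove_ratios : BddAbove M.ratios := by
  set P : Set (ℝ × ℝ) := {p : ℝ × ℝ | M.Physical ⟨p.1, p.2⟩}
  have hD : ContinuousOn (fun p => fderiv ℝ (fun p : ℝ × ℝ => M.V p.1 p.2) p) P := fun p hp =>
    ((M.contDiffAt_V p.2 hp.1 p.1 hp.2).continuousAt_fderiv one_ne_zero).continuousWithinAt
  have hV : ContinuousOn (fun p : ℝ × ℝ => M.vel ⟨p.1, p.2⟩) P := fun p hp =>
    (M.contDiffAt_V p.2 hp.1 p.1 hp.2).continuousAt.continuousWithinAt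
  have hVw : ContinuousOn (fun p : ℝ × ℝ => M.Vw ⟨p.1, p.2⟩) P :=
    (hD.clm_apply continuousOn_const).congr fun p hp => M.Vw_eq_fderiv hp
  have hVr : ContinuousOn (fun p : ℝ × ℝ => M.Vrho ⟨p.1, p.2⟩) P :=
    (hD.clm_apply continuousOn_const).congr fun p hp => M.Vrho_eq_fderiv hp
  have hK := (M.isCompact_physical.prod (M.isCompact_physical.prod M.isCompact_physical))
  have hcont : ContinuousOn (fun q : (ℝ × ℝ) × (ℝ × ℝ) × (ℝ × ℝ) =>
      -(M.Vw ⟨q.1.1, q.1.2⟩ / M.Vrho ⟨q.2.1.1, q.2.1.2⟩) * M.vel ⟨q.2.2.1, q.2.2.2⟩)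
      (P ×ˢ P ×ˢ P) := by
    refine ((hVw.comp continuousOn_fst fun q hq => hq.1).div
      (hVr.comp (continuous_fst.comp continuous_snd).continuousOn fun q hq => hq.2.1)
      fun q hq => (M.Vrho_neg hq.2.1).ne).neg.mul
      (hV.comp (continuous_snd.comp continuous_snd).continuousOn fun q hq => hq.2.2)
  refine (hK.bddAbove_image hcont).mono ?_
  rintro c ⟨U, U', U'', h, h', h'', -, rfl⟩
  exact ⟨((U.rho, U.w), (U'.rho, U'.w), (U''.rho, U''.w)), ⟨h, h', h''⟩, rfl⟩

theorem ratio_nonneg {U U' U'' : TrafficState} (h : M.Physical U) (h' : M.Physical U')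
    (h'' : M.Physical U'') : 0 ≤ -(M.Vw U / M.Vrho U') * M.vel U'' := by
  have := div_nonpos_of_nonneg_of_nonpos (M.Vw_nonneg h) (M.Vrho_neg h').le
  exact mul_nonneg (by linarith) (M.vel_nonneg h'')

theorem ratio_le {U U' U'' : TrafficState} (h : M.Physical U) (h' : M.Physical U')
    (h'' : M.Physical U'') (hw : U''.w = U'.w) :
    -(M.Vw U / M.Vrho U') * M.vel U'' ≤ sSup M.ratios :=
  le_csSup M.bddAbove_ratios ⟨U, U', U'', h, h', h'', hw, rfl⟩

theorem Cstar_nonneg : 0 ≤ M.Cstar := by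
  have h := M.physical_zero (left_mem_Icc.2 M.wL_le_wR)
  exact mul_nonneg two_pos.le ((M.ratio_nonneg h h h).trans (M.ratio_le h h h rfl))

theorem Cstar_pos {U : TrafficState} (hU : M.Physical U) (hne : M.Vw U ≠ 0) : 0 < M.Cstar := by
  have h := M.physical_zero hU.1
  have hvel : 0 < M.vel ⟨0, U.w⟩ := by
    have := M.strictAntiOn_V hU.1 h.2 (M.physical_rhoMax hU.1).2 (M.rhoMax_pos U.w hU.1)
    dsimp only at this
    rwa [M.V_rhoMax hU.1] at this
  have hdiv := div_neg_of_pos_of_neg ((M.Vw_nonneg hU).lt_of_ne' hne) (M.Vrho_neg h)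
  exact mul_pos two_pos ((mul_pos (neg_pos.2 hdiv) hvel).trans_le (M.ratio_le hU h h rfl))

/-- Two states with the same velocity have fluxes that differ at most by a multiple of the
difference of their properties `w`. -/
theorem abs_Q_sub_le {U U' : TrafficState} (hU : M.Physical U) (hU' : M.Physical U')
    (hvel : M.vel U = M.vel U') :
    |M.Q U' - M.Q U| ≤ sSup M.ratios * |U'.w - U.w| := by
  have hsub : uIcc U.w U'.w ⊆ Icc M.wL M.wR :=
    (convex_Icc _ _).ordConnected.uIcc_subset hU.1 hU'.1
  have hex : ∀ w ∈ uIcc U.w U'.w, ∃ r, M.Physical ⟨r, w⟩ ∧ M.V r w = M.vel U := by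
    intro w hw
    have h0 : M.vel U ≤ M.V 0 w := by
      have key : ∀ W : TrafficState, M.Physical W → W.w ≤ w → M.vel W ≤ M.V 0 w := fun W hW hle =>
        ((M.strictAntiOn_V hW.1).antitoneOn (M.physical_zero hW.1).2 hW.2 hW.2.1).trans
          (M.monotoneOn_V_zero hW.1 (hsub hw) hle)
      rcases min_le_iff.1 hw.1 with h | h
      · exact key U hU h
      · rw [hvel]; exact key U' hU' h
    obtain ⟨r, hr, hrv⟩ := intermediate_value_Icc' (M.rhoMax_pos w (hsub hw)).le
      (M.continuousOn_V (hsub hw))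
      (show M.vel U ∈ Icc _ _ from ⟨(M.V_rhoMax (hsub hw)).le.trans (M.vel_nonneg hU), h0⟩)
    exact ⟨r, ⟨hsub hw, hr⟩, hrv⟩
  choose! r hr using hex
  have hend : ∀ W : TrafficState, M.Physical W → W.w ∈ uIcc U.w U'.w → M.vel W = M.vel U →
      M.vel U * r W.w = M.Q W := by
    intro W hW hmem hv
    have : r W.w = W.rho := (M.strictAntiOn_V hW.1).injOn (hr _ hmem).1.2 hW.2
      ((hr _ hmem).2.trans hv.symm)
    rw [this, ← hv, mul_comm]; rfl
  rw [← hend U hU left_mem_uIcc rfl, ← hend U' hU' right_mem_uIcc hvel.symm]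
  refine Convex.norm_image_sub_le_of_norm_hasDerivWithin_le (s := uIcc U.w U'.w)
    (f := fun w => M.vel U * r w)
    (fun w hw => (M.hasDerivWithinAt_of_vel_eq hr hw).const_mul (M.vel U)) (fun w hw => ?_)
    (convex_uIcc _ _) left_mem_uIcc right_mem_uIcc
  have hp := (hr w hw).1
  have hv : M.vel U = M.vel ⟨r w, w⟩ := (hr w hw).2.symm
  rw [Real.norm_eq_abs, mul_comm, hv, abs_of_nonneg (M.ratio_nonneg hp hp hp)]
  exact M.ratio_le hp hp hp rfl

end GSOM

/-- `1` for a `w`-wave and `0` for a `ρ`-wave. -/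
def WaveFront.wBit (f : WaveFront) : ℕ :=
  match f.family with
  | WaveFamily.rho => 0
  | WaveFamily.w => 1

/-- The value of `w` on the left of a `w`-wave, as a list which is empty for a `ρ`-wave. -/
def WaveFront.wLeft (f : WaveFront) : List ℝ :=
  match f.family with
  | WaveFamily.rho => []
  | WaveFamily.w => [f.left.w]

theorem WaveFront.wBit_rho {f : WaveFront} (h : f.family = WaveFamily.rho) : f.wBit = 0 := by
  simp [wBit, h]

theorem WaveFront.wBit_w {f : WaveFront} (h : f.family = WaveFamily.w) : f.wBit = 1 := by
  simp [wBit, h]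

theorem WaveFront.wLeft_rho {f : WaveFront} (h : f.family = WaveFamily.rho) : f.wLeft = [] := by
  simp [wLeft, h]

theorem WaveFront.wLeft_w {f : WaveFront} (h : f.family = WaveFamily.w) :
    f.wLeft = [f.left.w] := by
  simp [wLeft, h]

theorem WaveFront.length_wLeft (f : WaveFront) : f.wLeft.length = f.wBit := by
  unfold wLeft wBit
  cases f.family <;> rfl

section Counting

variable (front : ℕ → WaveFront)

/-- The number of `w`-waves in a list of fronts. -/
def wCount (L : List ℕ) : ℕ := (L.map fun f => (front f).wBit).sum

/-- The number of `w`-waves that follow the front `f` in a list of fronts. -/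
def wAfter : List ℕ → ℕ → ℕ
  | [], _ => 0
  | x :: L, f => if x = f then wCount front L else wAfter L f

/-- The values of `w` on the left of the `w`-waves of a list of fronts, read from right to left. -/
def wLefts (L : List ℕ) : List ℝ := L.reverse.flatMap fun f => (front f).wLeft

@[simp] theorem wCount_nil : wCount front [] = 0 := rfl

@[simp] theorem wCount_cons (f : ℕ) (L : List ℕ) :
    wCount front (f :: L) = (front f).wBit + wCount front L := by simp [wCount]

@[simp] theorem wCount_append (A B : List ℕ) :
    wCount front (A ++ B) = wCount front A + wCount front B := by simp [wCount]

theorem wAfter_append_of_mem {A : List ℕ} {f : ℕ} (hf : f ∈ A) (B : List ℕ) :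
    wAfter front (A ++ B) f = wAfter front A f + wCount front B := by
  induction A with
  | nil => simp at hf
  | cons x A ih =>
    by_cases h : x = f
    · simp [wAfter, h]
    · simpa [wAfter, h] using ih (by simpa [Ne.symm h] using hf)

theorem wAfter_append_of_notMem {A : List ℕ} {f : ℕ} (hf : f ∉ A) (B : List ℕ) :
    wAfter front (A ++ B) f = wAfter front B f := by
  induction A with
  | nil => simp
  | cons x A ih =>
    simp only [List.mem_cons, not_or] at hf
    simpa [wAfter, Ne.symm hf.1] using ih hf.2

@[simp] theorem wAfter_cons_self (f : ℕ) (L : List ℕ) :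
    wAfter front (f :: L) f = wCount front L := by simp [wAfter]

theorem wAfter_cons_of_ne {x f : ℕ} (h : f ≠ x) (L : List ℕ) :
    wAfter front (x :: L) f = wAfter front L f := by simp [wAfter, h.symm]

theorem wAfter_le_wCount (L : List ℕ) (f : ℕ) : wAfter front L f ≤ wCount front L := by
  induction L with
  | nil => simp [wAfter]
  | cons x L ih =>
    by_cases h : x = f
    · simp [wAfter, h]
    · simp only [wAfter, h, if_false, wCount_cons]; omega

theorem pairwise_wAfter {L : List ℕ} (hL : L.Nodup) :
    L.Pairwise fun f g => wAfter front L g ≤ wAfter front L f := by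
  induction L with
  | nil => simp
  | cons x L ih =>
    have hx := (List.nodup_cons.1 hL).1
    have hne : ∀ g ∈ L, g ≠ x := fun g hg h => hx (h ▸ hg)
    refine List.pairwise_cons.2 ⟨fun g hg => ?_, (ih (List.nodup_cons.1 hL).2).imp_of_mem ?_⟩
    · rw [wAfter_cons_self, wAfter_cons_of_ne front (hne g hg)]
      exact wAfter_le_wCount front L g
    · intro f g hf hg h
      rwa [wAfter_cons_of_ne front (hne g hg), wAfter_cons_of_ne front (hne f hf)]

@[simp] theorem wLefts_nil : wLefts front [] = [] := rfl

@[simp] theorem wLefts_cons (f : ℕ) (L : List ℕ) :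
    wLefts front (f :: L) = wLefts front L ++ (front f).wLeft := by simp [wLefts]

@[simp] theorem wLefts_append (A B : List ℕ) :
    wLefts front (A ++ B) = wLefts front B ++ wLefts front A := by simp [wLefts]

theorem length_wLefts (L : List ℕ) : (wLefts front L).length = wCount front L := by
  induction L with
  | nil => rfl
  | cons f L ih => simp [ih, WaveFront.length_wLeft, add_comm]

theorem wCount_eq_zero {L : List ℕ} (h : ∀ f ∈ L, (front f).family = WaveFamily.rho) :
    wCount front L = 0 := by
  induction L with
  | nil => rfl
  | cons f L ih =>
    simp only [List.mem_cons, forall_eq_or_imp] at h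
    simp [ih h.2, WaveFront.wBit_rho h.1]

theorem wLefts_eq_nil {L : List ℕ} (h : ∀ f ∈ L, (front f).family = WaveFamily.rho) :
    wLefts front L = [] :=
  List.length_eq_zero_iff.1 ((length_wLefts front L).trans (wCount_eq_zero front h))

end Counting

section Profile

variable {front : ℕ → WaveFront}

theorem isProfile_append {U U' : TrafficState} {A B : List ℕ} :
    IsProfile front U (A ++ B) U' ↔ ∃ W, IsProfile front U A W ∧ IsProfile front W B U' := by
  induction A generalizing U with
  | nil => simp [IsProfile]
  | cons f A ih =>
    simp only [List.cons_append, IsProfile, ih]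
    exact ⟨fun ⟨h, W, h1, h2⟩ => ⟨W, ⟨h, h1⟩, h2⟩, fun ⟨W, ⟨h, h1⟩, h2⟩ => ⟨h, W, h1, h2⟩⟩

theorem IsProfile.right_unique {U W W' : TrafficState} {A : List ℕ}
    (h : IsProfile front U A W) (h' : IsProfile front U A W') : W = W' := by
  induction A generalizing U with
  | nil => exact h.symm.trans h'
  | cons f A ih => exact ih h.2 h'.2

theorem IsProfile.left_unique {U W W' : TrafficState} {A : List ℕ}
    (h : IsProfile front W A U) (h' : IsProfile front W' A U) : W = W' := by
  cases A with
  | nil => exact Eq.trans h h'.symm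
  | cons f A => exact h.1.symm.trans h'.1

theorem IsProfile.getElem?_wLefts {U U' : TrafficState} {L : List ℕ}
    (h : IsProfile front U L U')
    (hw : ∀ f ∈ L, (front f).family = WaveFamily.rho → (front f).left.w = (front f).right.w) :
    (U'.w :: wLefts front L)[wCount front L]? = some U.w := by
  induction L generalizing U with
  | nil => simp [show U = U' from h]
  | cons f L ih =>
    have ih := ih h.2 fun g hg => hw g (List.mem_cons_of_mem f hg)
    cases hf : (front f).family with
    | rho =>
      simp only [wLefts_cons, wCount_cons, WaveFront.wBit_rho hf, WaveFront.wLeft_rho hf,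
        List.append_nil, zero_add]
      rw [ih, ← h.1, hw f List.mem_cons_self hf]
    | w =>
      rw [wLefts_cons, wCount_cons, WaveFront.wBit_w hf, WaveFront.wLeft_w hf, add_comm,
        List.getElem?_cons_succ, ← length_wLefts, List.getElem?_concat_length, h.1]

end Profile

theorem GSOM.IsWave.physical_left {M : GSOM} {f : WaveFront} (h : M.IsWave f) :
    M.Physical f.left := h.1

theorem GSOM.IsWave.physical_right {M : GSOM} {f : WaveFront} (h : M.IsWave f) :
    M.Physical f.right := h.2.1

theorem GSOM.IsWave.isRhoWave {M : GSOM} {f : WaveFront} (h : M.IsWave f)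
    (hf : f.family = WaveFamily.rho) : M.IsRhoWave f := by
  have := h.2.2
  rwa [hf] at this

theorem GSOM.IsWave.isWWave {M : GSOM} {f : WaveFront} (h : M.IsWave f)
    (hf : f.family = WaveFamily.w) : M.IsWWave f := by
  have := h.2.2
  rwa [hf] at this

theorem GSOM.IsWave.w_eq {M : GSOM} {f : WaveFront} (h : M.IsWave f)
    (hf : f.family = WaveFamily.rho) : f.left.w = f.right.w := (h.isRhoWave hf).1

theorem GSOM.IsWave.left_ne_right {M : GSOM} {f : WaveFront} (h : M.IsWave f) :
    f.left ≠ f.right := by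
  intro heq
  cases hf : f.family with
  | rho => rcases (h.isRhoWave hf).2 with h | h <;> simp [heq] at h
  | w => exact (h.isWWave hf).1 (by rw [heq])

theorem GSOM.IsWave.family_of_speed_neg {M : GSOM} {f : WaveFront} (h : M.IsWave f)
    (hs : f.speed < 0) : f.family = WaveFamily.rho := by
  cases hf : f.family with
  | rho => rfl
  | w =>
    have := M.vel_nonneg h.physical_right
    rw [← (h.isWWave hf).2.2] at this
    linarith

/-- What an event at time `t` does to the list of fronts; `d` is the number of `w`-waves that leave
the road at its right end. -/
inductive Transition (front : ℕ → WaveFront) (J t : ℝ) : List ℕ → List ℕ → ℕ → Prop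
  | merge (A B : List ℕ) (l r g : ℕ) (hg : g ∉ A ++ l :: r :: B)
      (hlf : (front l).family = WaveFamily.rho) (hrf : (front r).family = WaveFamily.rho)
      (hgf : (front g).family = WaveFamily.rho) (htime : (front g).birthTime = t)
      (hleft : (front g).left = (front l).left) (hmid : (front l).right = (front r).left)
      (hright : (front g).right = (front r).right) :
      Transition front J t (A ++ l :: r :: B) (A ++ g :: B) 0
  | cross (A B : List ℕ) (c r g c' : ℕ) (hg : g ∉ A ++ c :: r :: B) (hc' : c' ∉ A ++ c :: r :: B)
      (hcf : (front c).family = WaveFamily.w) (hrf : (front r).family = WaveFamily.rho)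
      (hgf : (front g).family = WaveFamily.rho) (hcf' : (front c').family = WaveFamily.w)
      (htime : (front g).birthTime = t) (htime' : (front c').birthTime = t)
      (hleft : (front g).left = (front c).left) (hmid : (front c).right = (front r).left)
      (hmid' : (front g).right = (front c').left) (hright : (front c').right = (front r).right) :
      Transition front J t (A ++ c :: r :: B) (A ++ g :: c' :: B) 0
  | quiet (L N C N' : List ℕ) (d : ℕ) (hC : C.Sublist L)
      (hsub : L ⊆ N ++ C ++ N' ∨ N ++ C ++ N' ⊆ L)
      (hnew : ∀ f, f ∈ N ∨ f ∈ N' → f ∉ L ∧ (front f).birthTime = t ∧ (front f).birthPlace = J) :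
      Transition front J t L (N ++ C ++ N') d

section Event

variable {M : GSOM} {I : Road} {front : ℕ → WaveFront} {t : ℝ}

theorem TrackingEvent.exists_transition {P P' : RoadSnapshot} (h : TrackingEvent front I t P P')
    (hw : ∀ f ∈ P.fronts, M.IsWave (front f)) (hw' : ∀ f ∈ P'.fronts, M.IsWave (front f))
    (hp : IsProfile front P.left P.fronts P.right)
    (hp' : IsProfile front P'.left P'.fronts P'.right)
    (hn : P.fronts.Nodup) (hn' : P'.fronts.Nodup) :
    ∃ d, Transition front I.J t P.fronts P'.fronts d ∧ d ≤ wCount front P.fronts ∧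
      (∃ X, P'.right.w :: wLefts front P'.fronts =
        (P.right.w :: wLefts front P.fronts).drop d ++ X) ∧
      ∀ f ∈ P.fronts, f ∈ P'.fronts →
        wAfter front P.fronts f = d + wAfter front P'.fronts f := by
  cases h with
  | idle =>
    refine ⟨0, ?_, by simp, ⟨[], by simp⟩, by simp⟩
    simpa using Transition.quiet (J := I.J) (t := t) (front := front) P.fronts [] P.fronts [] 0
      (List.Sublist.refl _) (Or.inl (by simp)) (by simp)
  | merge U U' A B l r g hl hr hg hmeet hspeed hin htime hplace =>
    dsimp only at *
    obtain ⟨W, hA, hlW, hrW, hB⟩ := isProfile_append.1 hp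
    obtain ⟨W', hA', hgW, hB'⟩ := isProfile_append.1 hp'
    obtain rfl := hA.right_unique hA'
    have hright : (front g).right = (front r).right := hB'.left_unique hB
    have hleft : (front g).left = (front l).left := hgW.trans hlW.symm
    have hgn : g ∉ A ++ l :: r :: B := by
      have h1 : g ≠ l := by
        rintro rfl
        exact (hw r (by simp)).left_ne_right (hrW.trans hright)
      have h2 : g ≠ r := by
        rintro rfl
        exact (hw l (by simp)).left_ne_right (hleft.symm.trans hrW)
      have := (List.nodup_middle.1 hn')
      simp only [List.nodup_cons, List.mem_append] at this
      simp only [List.mem_append, List.mem_cons]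
      tauto
    refine ⟨0, .merge A B l r g hgn hl hr hg htime hleft hrW.symm hright, by simp, ⟨[], ?_⟩, ?_⟩
    · simp [WaveFront.wLeft_rho, hl, hr, hg]
    · intro f hf hf'
      have hfg : f ≠ g := fun h => hgn (h ▸ hf)
      by_cases hfA : f ∈ A
      · simp [wAfter_append_of_mem front hfA, WaveFront.wBit_rho, hl, hr, hg]
      · have hfB : f ∈ B := by simpa [hfA, hfg] using hf'
        have hnB := (List.nodup_append.1 hn).2.1
        simp only [List.nodup_cons, List.mem_cons, not_or] at hnB
        have h1 : f ≠ l := by rintro rfl; exact hnB.1.2 hfB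
        have h2 : f ≠ r := by rintro rfl; exact hnB.2.1 hfB
        simp [wAfter_append_of_notMem front hfA, wAfter_cons_of_ne front, h1, h2, hfg]
  | cancel U U' A B l r hl hr hmeet hspeed hin =>
    dsimp only at *
    refine ⟨0, ?_, by simp, ⟨[], ?_⟩, ?_⟩
    · simpa using Transition.quiet (J := I.J) (t := t) (front := front)
        (A ++ l :: r :: B) [] (A ++ B) [] 0
        ((List.Sublist.refl A).append ((List.sublist_cons_self r B).trans
          (List.sublist_cons_self l _)))
        (Or.inr (by intro x; simp; tauto)) (by simp)
    · simp [WaveFront.wLeft_rho, hl, hr]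
    · intro f hf hf'
      by_cases hfA : f ∈ A
      · simp [wAfter_append_of_mem front hfA, WaveFront.wBit_rho, hl, hr]
      · have hfB : f ∈ B := by simpa [hfA] using hf'
        have hnB := (List.nodup_append.1 hn).2.1
        simp only [List.nodup_cons, List.mem_cons, not_or] at hnB
        have h1 : f ≠ l := by rintro rfl; exact hnB.1.2 hfB
        have h2 : f ≠ r := by rintro rfl; exact hnB.2.1 hfB
        simp [wAfter_append_of_notMem front hfA, wAfter_cons_of_ne front, h1, h2]
  | cross U U' A B c r g c' hc hr hg hc' hmeet hspeed hin htime hplace htime' hplace' =>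
    dsimp only at *
    obtain ⟨W, hA, hcW, hrW, hB⟩ := isProfile_append.1 hp
    obtain ⟨W', hA', hgW, hcW', hB'⟩ := isProfile_append.1 hp'
    obtain rfl := hA.right_unique hA'
    have hright : (front c').right = (front r).right := hB'.left_unique hB
    have hleft : (front g).left = (front c).left := hgW.trans hcW.symm
    have hmem := List.nodup_append.1 hn'
    simp only [List.nodup_cons, List.mem_cons, not_or, forall_eq_or_imp] at hmem
    have hr1 := (hw r (by simp)).w_eq hr
    have hg1 := (hw' g (by simp)).w_eq hg
    have hc1 := ((hw c (by simp)).isWWave hc).1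
    have hgn : g ∉ A ++ c :: r :: B := by
      have h1 : g ≠ c := by rintro rfl; simp [hg] at hc
      have h2 : g ≠ r := by
        rintro rfl
        exact hc1 (by rw [← hleft, hrW])
      have h3 : g ∉ A := fun h => (hmem.2.2 g h).1 rfl
      simp only [List.mem_append, List.mem_cons]
      tauto
    have hcn : c' ∉ A ++ c :: r :: B := by
      have h1 : c' ≠ c := by
        rintro rfl
        exact (hw r (by simp)).left_ne_right (hrW.trans hright)
      have h2 : c' ≠ r := by rintro rfl; simp [hr] at hc'
      have h3 : c' ∉ A := fun h => (hmem.2.2 c' h).2.1 rfl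
      simp only [List.mem_append, List.mem_cons]
      tauto
    refine ⟨0, .cross A B c r g c' hgn hcn hc hr hg hc' htime htime' hleft hrW.symm hcW'.symm
      hright, by simp, ⟨[], ?_⟩, ?_⟩
    · have : (front c).left.w = (front c').left.w := by rw [← hleft, hcW', hg1]
      simp [WaveFront.wLeft_rho, WaveFront.wLeft_w, hc, hc', hr, hg, this]
    · intro f hf hf'
      have hfg : f ≠ g := fun h => hgn (h ▸ hf)
      have hfc : f ≠ c' := fun h => hcn (h ▸ hf)
      by_cases hfA : f ∈ A
      · simp [wAfter_append_of_mem front hfA, WaveFront.wBit_rho, WaveFront.wBit_w, hc, hc', hr, hg]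
      · have hfB : f ∈ B := by simpa [hfA, hfg, hfc] using hf'
        have hnB := (List.nodup_append.1 hn).2.1
        simp only [List.nodup_cons, List.mem_cons, not_or] at hnB
        have h1 : f ≠ c := by rintro rfl; exact hnB.1.2 hfB
        have h2 : f ≠ r := by rintro rfl; exact hnB.2.1 hfB
        simp [wAfter_append_of_notMem front hfA, wAfter_cons_of_ne front, h1, h2, hfg, hfc]
  | leaveRight U U' A f hpos hspeed =>
    dsimp only at *
    obtain ⟨W, hA, hfW, hU'⟩ := isProfile_append.1 hp
    have hU' : (front f).right = U' := hU'
    refine ⟨(front f).wBit, ?_, by simp, ⟨[], ?_⟩, ?_⟩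
    · simpa using Transition.quiet (J := I.J) (t := t) (front := front)
        (A ++ [f]) [] A [] (front f).wBit (List.sublist_append_left A [f])
        (Or.inr (by intro x; simp; tauto)) (by simp)
    · cases hf : (front f).family with
      | rho => simp [WaveFront.wLeft_rho hf, WaveFront.wBit_rho hf, ← hU', (hw f (by simp)).w_eq hf]
      | w => simp [WaveFront.wLeft_w hf, WaveFront.wBit_w hf]
    · intro x _ hx
      simp [wAfter_append_of_mem front hx, add_comm]
  | leaveLeft U U' B f hpos hspeed =>
    dsimp only at *
    have hf := (hw f (by simp)).family_of_speed_neg hspeed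
    refine ⟨0, ?_, by simp, ⟨[], ?_⟩, ?_⟩
    · simpa using Transition.quiet (J := I.J) (t := t) (front := front)
        (f :: B) [] B [] 0 (List.sublist_cons_self f B)
        (Or.inr (by intro x; simp; tauto)) (by simp)
    · simp [WaveFront.wLeft_rho hf]
    · intro x _ hx
      have : x ≠ f := by rintro rfl; exact (List.nodup_cons.1 hn).1 hx
      simp [wAfter_cons_of_ne front this]
  | emitIncoming U U' U'' A N hI hN =>
    dsimp only at *
    have hfam : ∀ f ∈ N, (front f).family = WaveFamily.rho := fun f hf =>
      (hw' f (by simp [hf])).family_of_speed_neg (hN f hf).2.2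
    have hdisj := (List.nodup_append.1 hn').2.2
    obtain ⟨W, hA, hNW⟩ := isProfile_append.1 hp'
    obtain rfl := hp.right_unique hA
    have hUw : U''.w = U'.w := by
      have := hNW.getElem?_wLefts fun f hf => (hw' f (by simp [hf])).w_eq
      simpa [wLefts_eq_nil front hfam, wCount_eq_zero front hfam] using this
    refine ⟨0, ?_, by simp, ⟨[], ?_⟩, ?_⟩
    · refine Transition.quiet A [] A N 0 (List.Sublist.refl A)
        (Or.inl (by simp)) fun f hf => ?_
      have hf : f ∈ N := by simpa using hf
      exact ⟨fun h => hdisj f h f hf rfl, (hN f hf).1, (hN f hf).2.1⟩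
    · simp [wLefts_eq_nil front hfam, hUw]
    · intro f hf _
      simp [wAfter_append_of_mem front hf, wCount_eq_zero front hfam]
  | emitOutgoing U U' U'' N B hI hN =>
    dsimp only at *
    have hdisj := (List.nodup_append.1 hn').2.2
    refine ⟨0, ?_, by simp, ⟨wLefts front N, by simp⟩, ?_⟩
    · have := Transition.quiet (J := I.J) (t := t) (front := front) B N B [] 0
        (List.Sublist.refl B) (Or.inl (by simp)) fun f hf => by
          have hf : f ∈ N := by simpa using hf
          exact ⟨fun h => hdisj f hf f h rfl, (hN f hf).1, (hN f hf).2.1⟩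
      simpa using this
    · intro f hf _
      have : f ∉ N := fun h => hdisj f h f hf rfl
      simp [wAfter_append_of_notMem front this]

end Event

/-- Lists that evolve by dropping entries at the front and appending entries at the end are windows
of one sequence. -/
theorem exists_sequence_of_windows {α : Type*} [Inhabited α] (Z : ℕ → List α) (d : ℕ → ℕ)
    (hd : ∀ n, d n ≤ (Z n).length) (hZ : ∀ n, ∃ X, Z (n + 1) = (Z n).drop (d n) ++ X) :
    ∃ om : ℕ → α, ∀ n j x, (Z n)[j]? = some x → om (∑ i ∈ Finset.range n, d i + j) = x := by
  choose X hX using hZ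
  let F : ℕ → List α := fun n => Nat.rec (Z 0) (fun n L => L ++ X n) n
  have hF : ∀ n, F (n + 1) = F n ++ X n := fun n => rfl
  have hdrop : ∀ n, ∑ i ∈ Finset.range n, d i ≤ (F n).length ∧
      (F n).drop (∑ i ∈ Finset.range n, d i) = Z n := by
    intro n
    induction n with
    | zero => simp [F]
    | succ n ih =>
      have hlen : ∑ i ∈ Finset.range n, d i + d n ≤ (F n).length := by
        have h1 := hd n
        rw [← ih.2, List.length_drop] at h1
        omega
      rw [Finset.sum_range_succ, hF]
      refine ⟨hlen.trans (by simp), ?_⟩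
      rw [List.drop_append_of_le_length hlen, hX, ← ih.2, List.drop_drop]
  have hmono : ∀ m n, m ≤ n → F m <+: F n := by
    intro m n hmn
    induction n, hmn using Nat.le_induction with
    | base => exact List.prefix_rfl
    | succ n _ ih => exact ih.trans (hF n ▸ List.prefix_append _ _)
  have hext : ∀ (m n i : ℕ) (x : α), m ≤ n → (F m)[i]? = some x → (F n)[i]? = some x := by
    intro m n i x hmn hx
    obtain ⟨T, hT⟩ := hmono m n hmn
    rwa [← hT, List.getElem?_append_left (List.getElem?_eq_some_iff.1 hx).1]
  have hget : ∀ (m n i : ℕ) (x y : α), (F m)[i]? = some x → (F n)[i]? = some y → x = y := by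
    intro m n i x y hx hy
    rcases le_total m n with h | h
    · exact Option.some.inj ((hext m n i x h hx).symm.trans hy)
    · exact Option.some.inj (hx.symm.trans (hext n m i y h hy))
  classical
  refine ⟨fun i => if h : ∃ x n, (F n)[i]? = some x then h.choose else default, ?_⟩
  intro n j x hx
  rw [← (hdrop n).2, List.getElem?_drop] at hx
  have hex : ∃ x n, (F n)[∑ i ∈ Finset.range n, d i + j]? = some x := ⟨x, n, hx⟩
  have hex' : ∃ x m, (F m)[∑ i ∈ Finset.range n, d i + j]? = some x := ⟨x, n, hx⟩
  dsimp only
  rw [dif_pos hex']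
  obtain ⟨m, hm⟩ := hex'.choose_spec
  exact hget _ _ _ _ _ hm hx

namespace FrontTracking

variable {M : GSOM} {I : Road} (S : FrontTracking M I)

theorem exists_shift : ∃ d : ℕ → ℕ, ∀ n,
    Transition S.front I.J (S.time (n + 1)) (S.snap n).fronts (S.snap (n + 1)).fronts (d n) ∧
      d n ≤ wCount S.front (S.snap n).fronts ∧
      (∃ X, (S.snap (n + 1)).right.w :: wLefts S.front (S.snap (n + 1)).fronts =
        ((S.snap n).right.w :: wLefts S.front (S.snap n).fronts).drop (d n) ++ X) ∧
      ∀ f ∈ (S.snap n).fronts, f ∈ (S.snap (n + 1)).fronts →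
        wAfter S.front (S.snap n).fronts f = d n + wAfter S.front (S.snap (n + 1)).fronts f :=
  Classical.axiomOfChoice fun n => (S.event n).exists_transition (S.isWave n) (S.isWave (n + 1))
    (S.profile n) (S.profile (n + 1)) (S.nodup n) (S.nodup (n + 1))

/-- The number of `w`-waves that leave the road at its right end at the event `n`. -/
noncomputable def shift : ℕ → ℕ := S.exists_shift.choose

theorem transition (n : ℕ) : Transition S.front I.J (S.time (n + 1)) (S.snap n).fronts
    (S.snap (n + 1)).fronts (S.shift n) := (S.exists_shift.choose_spec n).1

theorem wAfter_eq {n f : ℕ} (hf : f ∈ (S.snap n).fronts) (hf' : f ∈ (S.snap (n + 1)).fronts) :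
    wAfter S.front (S.snap n).fronts f =
      S.shift n + wAfter S.front (S.snap (n + 1)).fronts f :=
  (S.exists_shift.choose_spec n).2.2.2 f hf hf'

/-- The number of `w`-waves that have left the road at its right end before the event `n`. -/
noncomputable def offset (n : ℕ) : ℕ := ∑ i ∈ Finset.range n, S.shift i

theorem offset_succ (n : ℕ) : S.offset (n + 1) = S.offset n + S.shift n :=
  Finset.sum_range_succ _ _

/-- The number of `w`-waves of the road that are or have been ahead of the front `f` when it is
generated; it does not change during the life of `f`. -/
noncomputable def idx (f : ℕ) : ℕ :=
  S.offset (sInf {n | f ∈ (S.snap n).fronts}) +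
    wAfter S.front (S.snap (sInf {n | f ∈ (S.snap n).fronts})).fronts f

/-- The value of `idx f`, increased by one for `w`-waves. It does not decrease from mothers to
daughters. -/
noncomputable def height (f : ℕ) : ℕ := S.idx f + (S.front f).wBit

theorem mem_of_le_of_le {f m n k : ℕ} (hm : f ∈ (S.snap m).fronts) (hn : f ∈ (S.snap n).fronts)
    (hmk : m ≤ k) (hkn : k ≤ n) : f ∈ (S.snap k).fronts := by
  by_contra hk
  have : ∀ j, k ≤ j → f ∉ (S.snap j).fronts := by
    intro j hj
    induction j, hj using Nat.le_induction with
    | base => exact hk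
    | succ j hj ih => exact fun h => S.fresh j f h ih m (hmk.trans hj) hm
  exact this n hkn hn

theorem idx_eq {f n : ℕ} (hf : f ∈ (S.snap n).fronts) :
    S.idx f = S.offset n + wAfter S.front (S.snap n).fronts f := by
  have hb : f ∈ (S.snap (sInf {n | f ∈ (S.snap n).fronts})).fronts :=
    Nat.sInf_mem (s := {n | f ∈ (S.snap n).fronts}) ⟨n, hf⟩
  have hle : sInf {n | f ∈ (S.snap n).fronts} ≤ n := Nat.sInf_le hf
  unfold idx
  generalize sInf {n | f ∈ (S.snap n).fronts} = b at hb hle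
  induction n, hle using Nat.le_induction with
  | base => rfl
  | succ k hk ih =>
    have hfk := S.mem_of_le_of_le hb hf hk k.le_succ
    rw [ih hfk, S.wAfter_eq hfk hf, S.offset_succ, add_assoc]

theorem pairwise_idx (n : ℕ) :
    (S.snap n).fronts.Pairwise fun f g => S.idx g ≤ S.idx f :=
  (pairwise_wAfter S.front (S.nodup n)).imp_of_mem fun hf hg h => by
    rw [S.idx_eq hf, S.idx_eq hg]
    omega

theorem idx_of_append {n f : ℕ} {A B : List ℕ} (h : (S.snap n).fronts = A ++ f :: B) :
    S.idx f = S.offset n + wCount S.front B := by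
  have hn := S.nodup n
  rw [h] at hn
  have hfA : f ∉ A := fun hf => (List.nodup_append.1 hn).2.2 f hf f (by simp) rfl
  rw [S.idx_eq (n := n) (by simp [h]), h, wAfter_append_of_notMem S.front hfA, wAfter_cons_self]

/-- There is one sequence of values of `w` such that every front with index `i` has on its right
side the `i`-th value. -/
theorem exists_wSequence :
    ∃ om : ℕ → ℝ, ∀ n, ∀ f ∈ (S.snap n).fronts, (S.front f).right.w = om (S.idx f) := by
  obtain ⟨om, hom⟩ := exists_sequence_of_windows
    (fun n => (S.snap n).right.w :: wLefts S.front (S.snap n).fronts) S.shift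
    (fun n => (S.exists_shift.choose_spec n).2.1.trans (by simp [length_wLefts]))
    (fun n => (S.exists_shift.choose_spec n).2.2.1)
  refine ⟨om, fun n f hf => ?_⟩
  obtain ⟨A, B, hAB⟩ := List.append_of_mem hf
  have hp := S.profile n
  rw [hAB] at hp
  obtain ⟨W, -, -, hB⟩ := isProfile_append.1 hp
  have h1 := hB.getElem?_wLefts fun x hx => (S.isWave n x (by simp [hAB, hx])).w_eq
  rw [S.idx_of_append hAB]
  refine (hom n _ _ ?_).symm
  rw [hAB, wLefts_append, wLefts_cons, List.append_assoc, ← List.cons_append,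
    List.getElem?_append_left (by simp [length_wLefts]), h1]

theorem mother_event_unique {g n m : ℕ} (hg : g ∉ (S.snap n).fronts)
    (hg1 : g ∈ (S.snap (n + 1)).fronts) (hm : g ∉ (S.snap m).fronts)
    (hm1 : g ∈ (S.snap (m + 1)).fronts) : n = m := by
  rcases lt_trichotomy n m with h | h | h
  · exact absurd hg1 (S.fresh m g hm1 hm (n + 1) h)
  · exact h
  · exact absurd hm1 (S.fresh n g hg1 hg (m + 1) h)

/-- At the event `n` the `ρ`-waves `l` and `r` interact and generate the `ρ`-wave `g`. -/
structure IsMerge (n l r g : ℕ) : Prop where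
  left_rho : (S.front l).family = WaveFamily.rho
  right_rho : (S.front r).family = WaveFamily.rho
  rho : (S.front g).family = WaveFamily.rho
  mother_left : S.Mother l g
  mother_right : S.Mother r g
  birthTime : (S.front g).birthTime = S.time (n + 1)
  idx_left : S.idx l = S.idx g
  idx_right : S.idx r = S.idx g
  left : (S.front g).left = (S.front l).left
  mid : (S.front l).right = (S.front r).left
  right : (S.front g).right = (S.front r).right
  mothers : ∀ f, S.Mother f g → f = l ∨ f = r

/-- At the event `n` the `w`-wave `c` reaches the `ρ`-wave `r`, and they generate the `ρ`-wave `g` and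
the `w`-wave `c'`. -/
structure IsCross (n c r g c' : ℕ) : Prop where
  left_w : (S.front c).family = WaveFamily.w
  right_rho : (S.front r).family = WaveFamily.rho
  rho : (S.front g).family = WaveFamily.rho
  w : (S.front c').family = WaveFamily.w
  mother_left : S.Mother c g
  mother_right : S.Mother r g
  birthTime : (S.front g).birthTime = S.time (n + 1)
  birthTime' : (S.front c').birthTime = S.time (n + 1)
  idx_left : S.idx c = S.idx r
  idx_rho : S.idx g = S.idx r + 1
  idx_w : S.idx c' = S.idx r
  left : (S.front g).left = (S.front c).left
  mid : (S.front c).right = (S.front r).left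
  mid' : (S.front g).right = (S.front c').left
  right : (S.front c').right = (S.front r).right
  mothers : ∀ f, S.Mother f g ∨ S.Mother f c' → f = c ∨ f = r

/-- The three kinds of steps of a front tracking solution. -/
theorem step (n : ℕ) :
    (∃ A B l r g, (S.snap n).fronts = A ++ l :: r :: B ∧ (S.snap (n + 1)).fronts = A ++ g :: B ∧
      g ∉ (S.snap n).fronts ∧ S.IsMerge n l r g) ∨
    (∃ A B c r g c', (S.snap n).fronts = A ++ c :: r :: B ∧
      (S.snap (n + 1)).fronts = A ++ g :: c' :: B ∧
      g ∉ (S.snap n).fronts ∧ c' ∉ (S.snap n).fronts ∧ S.IsCross n c r g c') ∨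
    (∃ N C N', (S.snap (n + 1)).fronts = N ++ C ++ N' ∧ C.Sublist (S.snap n).fronts ∧
      ((S.snap n).fronts ⊆ (S.snap (n + 1)).fronts ∨
        (S.snap (n + 1)).fronts ⊆ (S.snap n).fronts) ∧
      ∀ f, f ∈ N ∨ f ∈ N' → f ∉ (S.snap n).fronts ∧
        (S.front f).birthTime = S.time (n + 1) ∧ (S.front f).birthPlace = I.J) := by
  have h := S.transition n
  generalize hL : (S.snap n).fronts = L at h
  generalize hL' : (S.snap (n + 1)).fronts = L' at h
  generalize hd : S.shift n = d at h
  have hn := S.nodup n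
  cases h with
  | merge A B l r g hg hlf hrf hgf htime hleft hmid hright =>
    left
    have hln : l ∈ (S.snap n).fronts := by simp [hL]
    have hrn : r ∈ (S.snap n).fronts := by simp [hL]
    have hgn : g ∈ (S.snap (n + 1)).fronts := by simp [hL']
    rw [← hL] at hg
    have hgl : g ≠ l := fun h => hg (h ▸ hln)
    have hgr : g ≠ r := fun h => hg (h ▸ hrn)
    have hmem := hn
    rw [hL, List.nodup_append] at hmem
    simp only [List.nodup_cons, List.mem_cons, not_or, forall_eq_or_imp] at hmem
    have hl1 : l ∉ (S.snap (n + 1)).fronts := by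
      simp only [hL', List.mem_append, List.mem_cons, not_or]
      exact ⟨fun h => (hmem.2.2 l h).1 rfl, hgl.symm, hmem.2.1.1.2⟩
    have hr1 : r ∉ (S.snap (n + 1)).fronts := by
      simp only [hL', List.mem_append, List.mem_cons, not_or]
      exact ⟨fun h => (hmem.2.2 r h).2.1 rfl, hgr.symm, hmem.2.1.2.1⟩
    have hidr : S.idx r = S.offset n + wCount S.front B :=
      S.idx_of_append (A := A ++ [l]) (by simp [hL])
    have hidg : S.idx g = S.offset n + wCount S.front B := by
      rw [S.idx_of_append hL', S.offset_succ, hd, add_zero]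
    have hidl : S.idx l = S.offset n + wCount S.front B := by
      rw [S.idx_of_append hL, wCount_cons, WaveFront.wBit_rho hrf, zero_add]
    refine ⟨A, B, l, r, g, rfl, rfl, by rwa [← hL], hlf, hrf, hgf, ⟨n, hln, hl1, hg, hgn⟩,
      ⟨n, hrn, hr1, hg, hgn⟩, htime, hidl.trans hidg.symm, hidr.trans hidg.symm, hleft, hmid,
      hright, ?_⟩
    rintro f ⟨m, hfm, hfm1, hgm, hgm1⟩
    obtain rfl := S.mother_event_unique hg hgn hgm hgm1
    rw [hL] at hfm
    rw [hL'] at hfm1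
    simp only [List.mem_append, List.mem_cons, not_or] at hfm hfm1
    tauto
  | cross A B c r g c' hg hc' hcf hrf hgf hcf' htime htime' hleft hmid hmid' hright =>
    right; left
    have hcn : c ∈ (S.snap n).fronts := by simp [hL]
    have hrn : r ∈ (S.snap n).fronts := by simp [hL]
    have hgn : g ∈ (S.snap (n + 1)).fronts := by simp [hL']
    have hcn' : c' ∈ (S.snap (n + 1)).fronts := by simp [hL']
    rw [← hL] at hg hc'
    have hgc : g ≠ c := fun h => hg (h ▸ hcn)
    have hgr : g ≠ r := fun h => hg (h ▸ hrn)
    have hcc : c' ≠ c := fun h => hc' (h ▸ hcn)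
    have hcr : c' ≠ r := fun h => hc' (h ▸ hrn)
    have hmem := hn
    rw [hL, List.nodup_append] at hmem
    simp only [List.nodup_cons, List.mem_cons, not_or, forall_eq_or_imp] at hmem
    have hc1 : c ∉ (S.snap (n + 1)).fronts := by
      simp only [hL', List.mem_append, List.mem_cons, not_or]
      exact ⟨fun h => (hmem.2.2 c h).1 rfl, hgc.symm, hcc.symm, hmem.2.1.1.2⟩
    have hr1 : r ∉ (S.snap (n + 1)).fronts := by
      simp only [hL', List.mem_append, List.mem_cons, not_or]
      exact ⟨fun h => (hmem.2.2 r h).2.1 rfl, hgr.symm, hcr.symm, hmem.2.1.2.1⟩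
    have hidr : S.idx r = S.offset n + wCount S.front B :=
      S.idx_of_append (A := A ++ [c]) (by simp [hL])
    have hidc : S.idx c = S.offset n + wCount S.front B := by
      rw [S.idx_of_append hL, wCount_cons, WaveFront.wBit_rho hrf, zero_add]
    have hidg : S.idx g = S.offset n + (1 + wCount S.front B) := by
      rw [S.idx_of_append hL', S.offset_succ, hd, add_zero, wCount_cons, WaveFront.wBit_w hcf']
    have hidc' : S.idx c' = S.offset n + wCount S.front B := by
      rw [S.idx_of_append (n := n + 1) (A := A ++ [g]) (B := B) (by simp [hL']), S.offset_succ, hd,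
        add_zero]
    refine ⟨A, B, c, r, g, c', rfl, rfl, by rwa [← hL], by rwa [← hL], hcf, hrf, hgf, hcf',
      ⟨n, hcn, hc1, hg, hgn⟩, ⟨n, hrn, hr1, hg, hgn⟩, htime, htime', by omega, by omega, by omega,
      hleft, hmid, hmid', hright, ?_⟩
    have key : ∀ f, f ∈ (S.snap n).fronts → f ∉ (S.snap (n + 1)).fronts → f = c ∨ f = r := by
      intro f hfm hfm1
      rw [hL] at hfm
      rw [hL'] at hfm1
      simp only [List.mem_append, List.mem_cons, not_or] at hfm hfm1
      tauto
    rintro f (⟨m, hfm, hfm1, hgm, hgm1⟩ | ⟨m, hfm, hfm1, hgm, hgm1⟩)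
    · obtain rfl := S.mother_event_unique hg hgn hgm hgm1
      exact key f hfm hfm1
    · obtain rfl := S.mother_event_unique hc' hcn' hgm hgm1
      exact key f hfm hfm1
  | quiet _ N C N' _ hC hsub hnew =>
    right; right
    exact ⟨N, C, N', rfl, hC, hsub, hnew⟩

theorem mother_cases {f g : ℕ} (h : S.Mother f g) :
    ∃ n, f ∈ (S.snap n).fronts ∧ f ∉ (S.snap (n + 1)).fronts ∧ g ∉ (S.snap n).fronts ∧
      g ∈ (S.snap (n + 1)).fronts ∧ (S.front g).birthTime = S.time (n + 1) ∧
      ((∃ l r, S.IsMerge n l r g ∧ (f = l ∨ f = r)) ∨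
      ∃ c r g₀ c', S.IsCross n c r g₀ c' ∧ (g = g₀ ∨ g = c') ∧ (f = c ∨ f = r)) := by
  obtain ⟨n, hf, hf1, hg, hg1⟩ := id h
  refine ⟨n, hf, hf1, hg, hg1, ?_⟩
  rcases S.step n with ⟨A, B, l, r, g', hL, hL', -, hm⟩ | ⟨A, B, c, r, g', c', hL, hL', -, -, hm⟩ |
    ⟨N, C, N', hL', hC, hsub, hnew⟩
  · have : g = g' := by
      simp only [hL, hL', List.mem_append, List.mem_cons, not_or] at hg hg1
      tauto
    subst this
    exact ⟨hm.birthTime, Or.inl ⟨l, r, hm, hm.mothers f h⟩⟩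
  · have hgg : g = g' ∨ g = c' := by
      simp only [hL, hL', List.mem_append, List.mem_cons, not_or] at hg hg1
      tauto
    refine ⟨?_, Or.inr ⟨c, r, g', c', hm, hgg, hm.mothers f ?_⟩⟩
    · rcases hgg with rfl | rfl
      exacts [hm.birthTime, hm.birthTime']
    · rcases hgg with rfl | rfl
      exacts [Or.inl h, Or.inr h]
  · rcases hsub with hs | hs
    · exact absurd (hs hf) hf1
    · exact absurd (hs hg1) hg

theorem height_rho {f : ℕ} (h : (S.front f).family = WaveFamily.rho) : S.height f = S.idx f := by
  rw [height, WaveFront.wBit_rho h, add_zero]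

theorem height_w {f : ℕ} (h : (S.front f).family = WaveFamily.w) :
    S.height f = S.idx f + 1 := by
  rw [height, WaveFront.wBit_w h]

theorem IsCross.height_eq {n c r g c' x : ℕ} (h : S.IsCross n c r g c') (hx : x = g ∨ x = c') :
    S.height x = S.idx r + 1 := by
  rcases hx with rfl | rfl
  · rw [S.height_rho h.rho, h.idx_rho]
  · rw [S.height_w h.w, h.idx_w]

theorem Mother.height_le {f g : ℕ} (h : S.Mother f g) : S.height f ≤ S.height g := by
  obtain ⟨n, -, -, -, -, -, ⟨l, r, hm, hf⟩ | ⟨c, r, g₀, c', hm, hg, hf⟩⟩ := S.mother_cases h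
  · rw [S.height_rho hm.rho]
    rcases hf with rfl | rfl
    · rw [S.height_rho hm.left_rho, hm.idx_left]
    · rw [S.height_rho hm.right_rho, hm.idx_right]
  · rw [hm.height_eq S hg]
    rcases hf with rfl | rfl
    · rw [S.height_w hm.left_w, hm.idx_left]
    · rw [S.height_rho hm.right_rho]; omega

theorem InTree.height_le {f g : ℕ} (h : S.InTree g f) : S.height f ≤ S.height g := by
  induction h with
  | refl => exact le_rfl
  | tail _ h ih => exact ih.trans (Mother.height_le S h)

theorem idx_of_merge {l r g : ℕ} (hlr : l ≠ r) (hl : S.Mother l g) (hr : S.Mother r g)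
    (hlf : (S.front l).family = WaveFamily.rho) (hrf : (S.front r).family = WaveFamily.rho) :
    (S.front g).family = WaveFamily.rho ∧ S.idx l = S.idx g ∧ S.idx r = S.idx g := by
  obtain ⟨n, -, -, -, -, -, ⟨l', r', hm, hf⟩ | ⟨c, r', g₀, c', hm, hg, hf⟩⟩ := S.mother_cases hl
  · refine ⟨hm.rho, ?_, ?_⟩
    · rcases hf with rfl | rfl
      exacts [hm.idx_left, hm.idx_right]
    · rcases hm.mothers r hr with rfl | rfl
      exacts [hm.idx_left, hm.idx_right]
  · have hr' : r = c ∨ r = r' := hm.mothers r (by rcases hg with rfl | rfl <;> simp [hr])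
    have := hm.left_w
    rcases hf with rfl | rfl <;> rcases hr' with rfl | rfl <;> simp_all

theorem height_of_cross {c r g : ℕ} (hc : S.Mother c g) (hr : S.Mother r g)
    (hcf : (S.front c).family = WaveFamily.w) (hrf : (S.front r).family = WaveFamily.rho) :
    S.height g = S.idx r + 1 := by
  obtain ⟨n, -, -, -, -, -, ⟨l', r', hm, hf⟩ | ⟨c₀, r', g₀, c', hm, hg, hf⟩⟩ := S.mother_cases hc
  · have h1 := hm.left_rho
    have h2 := hm.right_rho
    rcases hf with rfl | rfl <;> simp_all
  · have hr' : r = c₀ ∨ r = r' := hm.mothers r (by rcases hg with rfl | rfl <;> simp [hr])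
    have := hm.left_w
    rcases hr' with rfl | rfl
    · simp_all
    · exact hm.height_eq S hg

end FrontTracking

/-- The velocities on the left and right sides of the fronts in a list form a chain from `v` to
`v'`. -/
def VelChain (M : GSOM) (front : ℕ → WaveFront) : ℝ → List ℕ → ℝ → Prop
  | v, [], v' => v = v'
  | v, f :: L, v' => M.vel (front f).left = v ∧ VelChain M front (M.vel (front f).right) L v'

theorem VelChain.append {M : GSOM} {front : ℕ → WaveFront} {v v' v'' : ℝ} {A B : List ℕ}
    (hA : VelChain M front v A v') (hB : VelChain M front v' B v'') :
    VelChain M front v (A ++ B) v'' := by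
  induction A generalizing v with
  | nil => rwa [show v = v' from hA]
  | cons f A ih => exact ⟨hA.1, ih hA.2⟩

namespace FrontTracking

variable {M : GSOM} {I : Road} (S : FrontTracking M I)

theorem travelsAt_iff {tO : ℝ} {n₀ : ℕ} (h0 : S.time n₀ ≤ tO) (h1 : tO < S.time (n₀ + 1)) (f : ℕ) :
    S.TravelsAt tO f ↔ f ∈ (S.snap n₀).fronts := by
  refine ⟨?_, fun h => ⟨n₀, h0, h1, h⟩⟩
  rintro ⟨m, h2, h3, hf⟩
  rcases lt_trichotomy m n₀ with h | h | h
  · have := S.time_mono (show m + 1 ≤ n₀ from h)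
    linarith
  · rwa [← h]
  · have := S.time_mono (show n₀ + 1 ≤ m from h)
    linarith

theorem InBranch.family_eq {f g : ℕ} (h : S.InBranch g f) :
    (S.front f).family = (S.front g).family := by
  induction h with
  | refl => rfl
  | tail _ h ih => exact ih.trans h.2

theorem InBranch.inTree {f g : ℕ} (h : S.InBranch g f) : S.InTree g f :=
  Relation.ReflTransGen.mono (fun _ _ h => h.1) _ _ h

/-- A wave of level `k` has an ancestor at the original time whose index bounds `k`. -/
theorem Level.exists_ancestor {tO : ℝ} {n₀ f k : ℕ} (h0 : S.time n₀ ≤ tO)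
    (h1 : tO < S.time (n₀ + 1)) (h : S.Level tO f k) :
    ∃ x ∈ (S.snap n₀).fronts, S.InTree f x ∧ k + S.idx x ≤ S.height f + 1 := by
  induction h with
  | base f hf =>
    refine ⟨f, (S.travelsAt_iff h0 h1 f).1 hf, Relation.ReflTransGen.refl, ?_⟩
    unfold height
    omega
  | merge l r g i j hlr hl hr hlf hrf hg hi hj ihl ihr =>
    obtain ⟨hgf, hidl, hidr⟩ := S.idx_of_merge hlr hl hr hlf hrf
    rw [S.height_rho hlf] at ihl
    rw [S.height_rho hrf] at ihr
    rw [S.height_rho hgf]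
    rcases le_total i j with h | h
    · obtain ⟨x, hx, hxr, hle⟩ := ihr
      exact ⟨x, hx, hxr.tail hr, by rw [max_eq_right h]; omega⟩
    · obtain ⟨x, hx, hxl, hle⟩ := ihl
      exact ⟨x, hx, hxl.tail hl, by rw [max_eq_left h]; omega⟩
  | cross c r g k hc hr hcf hrf hg hk ih =>
    obtain ⟨x, hx, hxr, hle⟩ := ih
    rw [S.height_rho hrf] at hle
    refine ⟨x, hx, hxr.tail hr, ?_⟩
    rw [S.height_of_cross hc hr hcf hrf]
    omega

/-- The values of `w` along a sequence through all levels are consecutive values of the common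
sequence. -/
theorem IsLevelBranch.exists_start {tO : ℝ} {n₀ f k : ℕ} {om om' : ℕ → ℝ}
    (h0 : S.time n₀ ≤ tO) (h1 : tO < S.time (n₀ + 1))
    (hom : ∀ n, ∀ f ∈ (S.snap n).fronts, (S.front f).right.w = om (S.idx f))
    (h : S.IsLevelBranch tO om' f k) :
    ∃ x ∈ (S.snap n₀).fronts, S.idx f + 1 = S.idx x + k ∧
      ∀ j < k, om' (j + 1) = om (S.idx x + j) := by
  induction h with
  | base f hf hff h' =>
    have hf := (S.travelsAt_iff h0 h1 f).1 hf
    refine ⟨f, hf, rfl, fun j hj => ?_⟩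
    obtain rfl : j = 0 := by omega
    rw [zero_add, h', hom n₀ f hf, add_zero]
  | merge l r g k hlr hl hr hlf hrf hg hk hgk ih =>
    obtain ⟨x, hx, hidx, hj⟩ := ih
    exact ⟨x, hx, by rw [← (S.idx_of_merge hlr hl hr hlf hrf).2.1, hidx], hj⟩
  | cross c r g k hc hr hcf hrf hgf hg hk h' ih =>
    obtain ⟨x, hx, hidx, hj⟩ := ih
    have hh := S.height_of_cross hc hr hcf hrf
    rw [S.height_rho hgf] at hh
    refine ⟨x, hx, by omega, fun j hjk => ?_⟩
    rcases Nat.lt_succ_iff_lt_or_eq.1 hjk with h | rfl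
    · exact hj j h
    · obtain ⟨n, -, -, -, hgn⟩ := hc
      rw [h', hom (n + 1) g hgn]
      congr 1
      omega

/-- A front generated after the event `n₀` traces back to the snapshot `n₀` through its mothers. -/
theorem exists_mother_of_inTree {n₀ n g x : ℕ} (hn : n₀ ≤ n) (hg : g ∉ (S.snap n).fronts)
    (hg1 : g ∈ (S.snap (n + 1)).fronts) (hx : x ∈ (S.snap n₀).fronts) (h : S.InTree g x) :
    ∃ m, S.Mother m g ∧ m ∈ (S.snap n).fronts ∧ m ∉ (S.snap (n + 1)).fronts ∧ S.InTree m x := by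
  rcases Relation.ReflTransGen.cases_tail h with rfl | ⟨m, hm, hmg⟩
  · exact absurd hx (S.fresh n _ hg1 hg n₀ hn)
  · obtain ⟨k, hk, hk1, hgk, hgk1⟩ := id hmg
    obtain rfl := S.mother_event_unique hg hg1 hgk hgk1
    exact ⟨m, hmg, hk, hk1, hm⟩

/-- The list `s` of fronts represents the wave `f` at the original time: it is a chain of waves of
the backward wave branch of `f`, and the one of least index determines the level of `f`. -/
structure Represents (tO : ℝ) (om : ℕ → ℝ) (f : ℕ) (s : List ℕ) : Prop where
  chain : VelChain M S.front (M.vel (S.front f).left) s (M.vel (S.front f).right)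
  inBranch : ∀ x ∈ s, S.InBranch f x
  idx_le : ∀ x ∈ s, S.idx x ≤ S.idx f
  level : ∃ a ∈ s, (∀ b ∈ s, S.idx a ≤ S.idx b) ∧ ∃ k, S.idx f + 1 = S.idx a + k ∧
    S.Level tO f k ∧ S.IsLevelBranch tO (fun i => om (S.idx a + i - 1)) f k

theorem Represents.merge {tO : ℝ} {om : ℕ → ℝ} {n l r g : ℕ} {s s' : List ℕ}
    (h : S.IsMerge n l r g) (htime : tO < (S.front g).birthTime)
    (hl : S.Represents tO om l s) (hr : S.Represents tO om r s') :
    S.Represents tO om g (s ++ s') := by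
  have hfl : (S.front l).family = (S.front g).family := h.left_rho.trans h.rho.symm
  have hfr : (S.front r).family = (S.front g).family := h.right_rho.trans h.rho.symm
  have hil := h.idx_left
  have hir := h.idx_right
  refine ⟨?_, ?_, ?_, ?_⟩
  · have := hl.chain
    rw [h.mid, ← h.left] at this
    have hr := hr.chain
    rw [← h.right] at hr
    exact this.append hr
  · intro x hx
    rcases List.mem_append.1 hx with hx | hx
    · exact (hl.inBranch x hx).tail ⟨h.mother_left, hfl⟩
    · exact (hr.inBranch x hx).tail ⟨h.mother_right, hfr⟩
  · intro x hx
    rcases List.mem_append.1 hx with hx | hx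
    · exact hil ▸ hl.idx_le x hx
    · exact hir ▸ hr.idx_le x hx
  · obtain ⟨a, ha, hamin, k, hk, hkl, hkb⟩ := hl.level
    obtain ⟨a', ha', hamin', k', hk', hkl', hkb'⟩ := hr.level
    have hlr : l ≠ r := by
      rintro rfl
      obtain ⟨m, hm, -⟩ := h.mother_left
      exact (S.isWave m l hm).left_ne_right h.mid.symm
    have hlev := Level.merge l r g k k' hlr h.mother_left h.mother_right h.left_rho h.right_rho
      htime hkl hkl'
    rcases le_total (S.idx a) (S.idx a') with hle | hle
    · rw [max_eq_left (by omega)] at hlev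
      refine ⟨a, by simp [ha], fun b hb => ?_, k, by omega, hlev,
        .merge l r g k hlr h.mother_left h.mother_right h.left_rho h.right_rho htime hkb hlev⟩
      rcases List.mem_append.1 hb with hb | hb
      exacts [hamin b hb, hle.trans (hamin' b hb)]
    · rw [max_eq_right (by omega)] at hlev
      refine ⟨a', by simp [ha'], fun b hb => ?_, k', by omega, hlev,
        .merge r l g k' hlr.symm h.mother_right h.mother_left h.right_rho h.left_rho htime hkb'
          hlev⟩
      rcases List.mem_append.1 hb with hb | hb
      exacts [hle.trans (hamin b hb), hamin' b hb]

theorem Represents.cross {tO : ℝ} {om : ℕ → ℝ} {n c r g c' : ℕ} {s : List ℕ}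
    (hom : ∀ n, ∀ f ∈ (S.snap n).fronts, (S.front f).right.w = om (S.idx f))
    (h : S.IsCross n c r g c') (hc : c ∈ (S.snap n).fronts) (hg : g ∈ (S.snap (n + 1)).fronts)
    (hc' : c' ∈ (S.snap (n + 1)).fronts) (htime : tO < (S.front g).birthTime)
    (hr : S.Represents tO om r s) : S.Represents tO om g s := by
  have hfr : (S.front r).family = (S.front g).family := h.right_rho.trans h.rho.symm
  have hidx := h.idx_rho
  refine ⟨?_, fun x hx => (hr.inBranch x hx).tail ⟨h.mother_right, hfr⟩,
    fun x hx => by have := hr.idx_le x hx; omega, ?_⟩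
  · rw [h.left, h.mid', ((S.isWave n c hc).isWWave h.left_w).2.1,
      ((S.isWave (n + 1) c' hc').isWWave h.w).2.1, h.mid, h.right]
    exact hr.chain
  · obtain ⟨a, ha, hamin, k, hk, hkl, hkb⟩ := hr.level
    refine ⟨a, ha, hamin, k + 1, by omega, .cross c r g k h.mother_left h.mother_right h.left_w
      h.right_rho htime hkl, .cross c r g k h.mother_left h.mother_right h.left_w
      h.right_rho h.rho htime hkb ?_⟩
    rw [hom (n + 1) g hg]
    congr 1
    omega

/-- The assignment `al` of lists of waves at the original time to the fronts of the snapshot `n`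
represents the fronts in the backward wave branch of `R`. -/
structure Ancestry (tO : ℝ) (om : ℕ → ℝ) (n₀ R n : ℕ) (al : ℕ → List ℕ) : Prop where
  sublist : ((S.snap n).fronts.flatMap al).Sublist (S.snap n₀).fronts
  represents : ∀ f ∈ (S.snap n).fronts, S.InBranch R f → S.Represents tO om f (al f)
  self : ∀ f ∈ (S.snap n).fronts, ∀ x ∈ (S.snap n₀).fronts, S.InTree f x → S.InBranch R f →
    ∃ a ∈ al f, S.idx a ≤ S.idx x
  pairwise : (S.snap n).fronts.Pairwise fun f h => ∀ x ∈ (S.snap n₀).fronts, S.InTree f x →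
    S.InBranch R h → ∃ a ∈ al h, S.idx a ≤ S.idx x

theorem Ancestry.base {tO : ℝ} {om : ℕ → ℝ} {n₀ R : ℕ} (h0 : S.time n₀ ≤ tO)
    (h1 : tO < S.time (n₀ + 1))
    (hom : ∀ n, ∀ f ∈ (S.snap n).fronts, (S.front f).right.w = om (S.idx f))
    (hR : (S.front R).family = WaveFamily.rho) : S.Ancestry tO om n₀ R n₀ fun f => [f] := by
  have hanc : ∀ f x, x ∈ (S.snap n₀).fronts → f ∈ (S.snap n₀).fronts → S.InTree f x → x = f := by
    intro f x hx hf h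
    rcases Relation.ReflTransGen.cases_head h with rfl | ⟨m, hxm, hmf⟩
    · rfl
    · exfalso
      have key : ∀ g, S.InTree g m → ∃ k, n₀ ≤ k ∧ g ∉ (S.snap k).fronts ∧
          g ∈ (S.snap (k + 1)).fronts := by
        intro g hg
        induction hg with
        | refl =>
          obtain ⟨k, hxk, hxk1, hmk, hmk1⟩ := hxm
          refine ⟨k, ?_, hmk, hmk1⟩
          by_contra! hlt
          exact hxk1 (S.mem_of_le_of_le hxk hx (Nat.le_succ k) hlt)
        | tail _ hbc ih =>
          obtain ⟨k, hk, hbk, hbk1⟩ := ih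
          obtain ⟨j, hbj, hbj1, hcj, hcj1⟩ := hbc
          refine ⟨j, ?_, hcj, hcj1⟩
          by_contra! hlt
          exact S.fresh k _ hbk1 hbk j (hlt.le.trans hk) hbj
      obtain ⟨k, hk, hfk, hfk1⟩ := key f hmf
      exact S.fresh k f hfk1 hfk n₀ hk hf
  refine ⟨by simp, fun f hf hfR => ⟨⟨rfl, rfl⟩, ?_, ?_, ?_⟩, ?_, ?_⟩
  · intro x hx
    obtain rfl := List.mem_singleton.1 hx
    exact Relation.ReflTransGen.refl
  · intro x hx
    obtain rfl := List.mem_singleton.1 hx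
    exact le_rfl
  · have ht := (S.travelsAt_iff h0 h1 f).2 hf
    refine ⟨f, by simp, by simp, 1, rfl, .base f ht, .base f ht
      ((InBranch.family_eq S hfR).trans hR) ?_⟩
    rw [hom n₀ f hf, Nat.add_sub_cancel]
  · intro f hf x hx hfx _
    exact ⟨f, by simp, by rw [hanc f x hx hf hfx]⟩
  · refine (S.pairwise_idx n₀).imp_of_mem fun {f h} hf hh hle x hx hfx _ => ⟨h, by simp, ?_⟩
    rw [hanc f x hx hf hfx]
    exact hle

theorem flatMap_congr_of_eq {α β : Type*} {L : List α} {F G : α → List β}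
    (h : ∀ x ∈ L, F x = G x) : L.flatMap F = L.flatMap G := by
  induction L with
  | nil => rfl
  | cons x L ih =>
    simp only [List.mem_cons, forall_eq_or_imp] at h
    simp [h.1, ih h.2]

theorem Ancestry.step {tO : ℝ} {om : ℕ → ℝ} {n₀ R n : ℕ} {al : ℕ → List ℕ}
    (h1 : tO < S.time (n₀ + 1)) (hn : n₀ ≤ n) (hRf : (S.front R).family = WaveFamily.rho)
    (hom : ∀ n, ∀ f ∈ (S.snap n).fronts, (S.front f).right.w = om (S.idx f))
    (hR : ∀ f, S.InBranch R f → (S.front f).birthPlace = I.J → (S.front f).birthTime ≤ tO)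
    (h : S.Ancestry tO om n₀ R n al) : ∃ al', S.Ancestry tO om n₀ R (n + 1) al' := by
  classical
  have htime : tO < S.time (n + 1) := h1.trans_le (S.time_mono (by omega))
  obtain ⟨hsub, hrep, hself, hpair⟩ := h
  rcases S.step n with ⟨A, B, l, r, g, hL, hL', hg, hm⟩ |
    ⟨A, B, c, r, g, c', hL, hL', hg, hc', hm⟩ | ⟨N, C, N', hL', hC, hsubset, hnew⟩
  · have hln : l ∈ (S.snap n).fronts := by simp [hL]
    have hrn : r ∈ (S.snap n).fronts := by simp [hL]
    have hgn : g ∈ (S.snap (n + 1)).fronts := by simp [hL']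
    have hAB : ∀ f, f ∈ A ∨ f ∈ B → f ∈ (S.snap n).fronts := by
      intro f hf
      simp only [hL, List.mem_append, List.mem_cons]
      tauto
    have hne : ∀ f, f ∈ (S.snap n).fronts →
        Function.update al g (al l ++ al r) f = al f := fun f hf =>
      Function.update_of_ne (by rintro rfl; exact hg hf) _ _
    have hlR : S.InBranch R g → S.InBranch R l := fun h =>
      h.head ⟨hm.mother_left, hm.left_rho.trans hm.rho.symm⟩
    have hrR : S.InBranch R g → S.InBranch R r := fun h =>
      h.head ⟨hm.mother_right, hm.right_rho.trans hm.rho.symm⟩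
    have htree : ∀ x ∈ (S.snap n₀).fronts, S.InTree g x → S.InTree l x ∨ S.InTree r x := by
      intro x hx hgx
      obtain ⟨m, hmg, -, -, hmx⟩ := S.exists_mother_of_inTree hn hg hgn hx hgx
      rcases hm.mothers m hmg with rfl | rfl
      exacts [Or.inl hmx, Or.inr hmx]
    rw [hL, List.pairwise_append, List.pairwise_cons, List.pairwise_cons] at hpair
    simp only [List.mem_cons, forall_eq_or_imp] at hpair
    obtain ⟨hpA, ⟨⟨hplr, hplB⟩, hprB, hpB⟩, hpAll⟩ := hpair
    refine ⟨Function.update al g (al l ++ al r), ?_, ?_, ?_, ?_⟩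
    · have : (S.snap (n + 1)).fronts.flatMap (Function.update al g (al l ++ al r)) =
          (S.snap n).fronts.flatMap al := by
        simp only [hL, hL', List.flatMap_append, List.flatMap_cons, Function.update_self,
          List.append_assoc]
        rw [flatMap_congr_of_eq fun f hf => hne f (hAB f (Or.inl hf)),
          flatMap_congr_of_eq fun f hf => hne f (hAB f (Or.inr hf))]
      rwa [this]
    · intro f hf hfR
      by_cases hfg : f = g
      · subst hfg
        rw [Function.update_self]
        exact .merge S hm (hm.birthTime ▸ htime) (hrep l hln (hlR hfR)) (hrep r hrn (hrR hfR))
      · have hfn : f ∈ (S.snap n).fronts := by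
          simp only [hL', List.mem_append, List.mem_cons, hfg, false_or] at hf
          exact hAB f hf
        rw [hne f hfn]
        exact hrep f hfn hfR
    · intro f hf x hx hfx hfR
      by_cases hfg : f = g
      · subst hfg
        rw [Function.update_self]
        rcases htree x hx hfx with h | h
        · obtain ⟨a, ha, hax⟩ := hplr x hx h (hrR hfR)
          exact ⟨a, by simp [ha], hax⟩
        · obtain ⟨a, ha, hax⟩ := hself r hrn x hx h (hrR hfR)
          exact ⟨a, by simp [ha], hax⟩
      · have hfn : f ∈ (S.snap n).fronts := by
          simp only [hL', List.mem_append, List.mem_cons, hfg, false_or] at hf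
          exact hAB f hf
        rw [hne f hfn]
        exact hself f hfn x hx hfx hfR
    · rw [hL', List.pairwise_append, List.pairwise_cons]
      simp only [List.mem_cons, forall_eq_or_imp]
      refine ⟨hpA.imp_of_mem fun {f h} _ hh hT => ?_, ⟨fun b hb x hx hgx hbR => ?_,
        hpB.imp_of_mem fun {f h} _ hh hT => ?_⟩, fun f hf => ⟨fun x hx hfx hgR => ?_,
        fun b hb => ?_⟩⟩
      · rwa [hne h (hAB h (Or.inl hh))]
      · rw [hne b (hAB b (Or.inr hb))]
        rcases htree x hx hgx with h | h
        exacts [hplB b hb x hx h hbR, hprB b hb x hx h hbR]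
      · rwa [hne h (hAB h (Or.inr hh))]
      · obtain ⟨a, ha, hax⟩ := (hpAll f hf).2.1 x hx hfx (hrR hgR)
        exact ⟨a, by simp [ha], hax⟩
      · rw [hne b (hAB b (Or.inr hb))]
        exact (hpAll f hf).2.2 b hb
  · have hcn : c ∈ (S.snap n).fronts := by simp [hL]
    have hrn : r ∈ (S.snap n).fronts := by simp [hL]
    have hgn : g ∈ (S.snap (n + 1)).fronts := by simp [hL']
    have hcn' : c' ∈ (S.snap (n + 1)).fronts := by simp [hL']
    have hgc' : g ≠ c' := by
      rintro rfl
      have := hm.rho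
      rw [hm.w] at this
      cases this
    have hAB : ∀ f, f ∈ A ∨ f ∈ B → f ∈ (S.snap n).fronts := by
      intro f hf
      simp only [hL, List.mem_append, List.mem_cons]
      tauto
    set al' := Function.update (Function.update al g (al r)) c' [] with hal'
    have hne : ∀ f, f ∈ (S.snap n).fronts → al' f = al f := fun f hf =>
      (Function.update_of_ne (by rintro rfl; exact hc' hf) _ _).trans
        (Function.update_of_ne (by rintro rfl; exact hg hf) _ _)
    have hal'g : al' g = al r := by
      rw [hal', Function.update_of_ne hgc', Function.update_self]
    have hal'c : al' c' = [] := Function.update_self _ _ _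
    have hrR : S.InBranch R g → S.InBranch R r := fun h =>
      h.head ⟨hm.mother_right, hm.right_rho.trans hm.rho.symm⟩
    have hcR : ¬ S.InBranch R c' := by
      intro h
      have := InBranch.family_eq S h
      rw [hRf, hm.w] at this
      cases this
    have htree : ∀ y, y = g ∨ y = c' → ∀ x ∈ (S.snap n₀).fronts, S.InTree y x →
        S.InTree c x ∨ S.InTree r x := by
      intro y hy x hx hyx
      have : y ∉ (S.snap n).fronts ∧ y ∈ (S.snap (n + 1)).fronts := by
        rcases hy with rfl | rfl
        exacts [⟨hg, hgn⟩, ⟨hc', hcn'⟩]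
      obtain ⟨m, hmg, -, -, hmx⟩ := S.exists_mother_of_inTree hn this.1 this.2 hx hyx
      rcases hm.mothers m (by rcases hy with rfl | rfl <;> simp [hmg]) with rfl | rfl
      exacts [Or.inl hmx, Or.inr hmx]
    rw [hL, List.pairwise_append, List.pairwise_cons, List.pairwise_cons] at hpair
    simp only [List.mem_cons, forall_eq_or_imp] at hpair
    obtain ⟨hpA, ⟨⟨hpcr, hpcB⟩, hprB, hpB⟩, hpAll⟩ := hpair
    have hcases : ∀ f ∈ (S.snap (n + 1)).fronts, f = g ∨ f = c' ∨ f ∈ (S.snap n).fronts := by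
      intro f hf
      simp only [hL', List.mem_append, List.mem_cons] at hf
      rcases hf with h | h | h | h
      exacts [Or.inr (Or.inr (hAB f (Or.inl h))), Or.inl h, Or.inr (Or.inl h),
        Or.inr (Or.inr (hAB f (Or.inr h)))]
    refine ⟨al', ?_, ?_, ?_, ?_⟩
    · refine List.Sublist.trans ?_ hsub
      simp only [hL, hL', List.flatMap_append, List.flatMap_cons, hal'g, hal'c, List.nil_append]
      rw [flatMap_congr_of_eq fun f hf => hne f (hAB f (Or.inl hf)),
        flatMap_congr_of_eq fun f hf => hne f (hAB f (Or.inr hf))]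
      exact (List.Sublist.refl _).append (List.sublist_append_right _ _)
    · intro f hf hfR
      rcases hcases f hf with rfl | rfl | hfn
      · rw [hal'g]
        exact .cross S hom hm hcn hgn hcn' (hm.birthTime ▸ htime) (hrep r hrn (hrR hfR))
      · exact absurd hfR hcR
      · rw [hne f hfn]
        exact hrep f hfn hfR
    · intro f hf x hx hfx hfR
      rcases hcases f hf with rfl | rfl | hfn
      · rw [hal'g]
        rcases htree f (Or.inl rfl) x hx hfx with h | h
        exacts [hpcr x hx h (hrR hfR), hself r hrn x hx h (hrR hfR)]
      · exact absurd hfR hcR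
      · rw [hne f hfn]
        exact hself f hfn x hx hfx hfR
    · have htreeB : ∀ y, y = g ∨ y = c' → ∀ b ∈ B, ∀ x ∈ (S.snap n₀).fronts, S.InTree y x →
          S.InBranch R b → ∃ a ∈ al' b, S.idx a ≤ S.idx x := by
        intro y hy b hb x hx hyx hbR
        rw [hne b (hAB b (Or.inr hb))]
        rcases htree y hy x hx hyx with h | h
        exacts [hpcB b hb x hx h hbR, hprB b hb x hx h hbR]
      rw [hL', List.pairwise_append, List.pairwise_cons, List.pairwise_cons]
      simp only [List.mem_cons, forall_eq_or_imp]
      refine ⟨hpA.imp_of_mem fun {f h} _ hh hT => ?_, ⟨⟨fun x _ _ h => absurd h hcR,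
        htreeB g (Or.inl rfl)⟩, htreeB c' (Or.inr rfl),
        hpB.imp_of_mem fun {f h} _ hh hT => ?_⟩, fun f hf => ⟨fun x hx hfx hgR => ?_,
        fun x _ _ h => absurd h hcR, fun b hb => ?_⟩⟩
      · rwa [hne h (hAB h (Or.inl hh))]
      · rwa [hne h (hAB h (Or.inr hh))]
      · rw [hal'g]
        exact (hpAll f hf).2.1 x hx hfx (hrR hgR)
      · rw [hne b (hAB b (Or.inr hb))]
        exact (hpAll f hf).2.2 b hb
  · have hCn : ∀ f ∈ C, f ∈ (S.snap n).fronts := fun f hf => hC.subset hf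
    have hmem : ∀ f ∈ (S.snap (n + 1)).fronts, f ∈ C ∨ f ∈ N ∨ f ∈ N' := by
      intro f hf
      simp only [hL', List.mem_append] at hf
      tauto
    set al' : ℕ → List ℕ := fun f => if f ∈ (S.snap n).fronts then al f else []
    have hold : ∀ f ∈ C, al' f = al f := fun f hf => if_pos (hCn f hf)
    have hnil : ∀ f, f ∈ N ∨ f ∈ N' → al' f = [] := fun f hf => if_neg (hnew f hf).1
    have hnR : ∀ f, f ∈ N ∨ f ∈ N' → ¬ S.InBranch R f := by
      intro f hf hfR
      have := hR f hfR (hnew f hf).2.2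
      rw [(hnew f hf).2.1] at this
      exact absurd htime this.not_gt
    have hntree : ∀ f, f ∈ N ∨ f ∈ N' → ∀ x ∈ (S.snap n₀).fronts, ¬ S.InTree f x := by
      intro f hf x hx hfx
      have hf1 : f ∈ (S.snap (n + 1)).fronts := by
        simp only [hL', List.mem_append]
        tauto
      obtain ⟨m, -, hm, hm1, -⟩ := S.exists_mother_of_inTree hn (hnew f hf).1 hf1 hx hfx
      rcases hsubset with hs | hs
      exacts [hm1 (hs hm), (hnew f hf).1 (hs hf1)]
    refine ⟨al', ?_, ?_, ?_, ?_⟩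
    · rw [hL', List.flatMap_append, List.flatMap_append, flatMap_congr_of_eq hold,
        List.flatMap_eq_nil_iff.2 fun f hf => hnil f (Or.inl hf),
        List.flatMap_eq_nil_iff.2 fun f hf => hnil f (Or.inr hf), List.nil_append, List.append_nil]
      exact (hC.flatMap al).trans hsub
    · intro f hf hfR
      rcases hmem f hf with h | h
      · rw [hold f h]
        exact hrep f (hCn f h) hfR
      · exact absurd hfR (hnR f h)
    · intro f hf x hx hfx hfR
      rcases hmem f hf with h | h
      · rw [hold f h]
        exact hself f (hCn f h) x hx hfx hfR
      · exact absurd hfR (hnR f h)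
    · rw [hL', List.pairwise_append, List.pairwise_append]
      refine ⟨⟨?_, ?_, ?_⟩, ?_, ?_⟩
      · exact List.pairwise_of_forall_mem_list fun f hf _ _ x hx hfx =>
          absurd hfx (hntree f (Or.inl hf) x hx)
      · refine (hpair.sublist hC).imp_of_mem fun {f h} _ hh hT => ?_
        rwa [hold h hh]
      · exact fun f hf _ _ x hx hfx => absurd hfx (hntree f (Or.inl hf) x hx)
      · exact List.pairwise_of_forall_mem_list fun f hf _ _ x hx hfx =>
          absurd hfx (hntree f (Or.inr hf) x hx)
      · exact fun _ _ h hh _ _ _ hhR => absurd hhR (hnR h (Or.inr hh))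

theorem exists_ancestry {tO : ℝ} {om : ℕ → ℝ} {n₀ R n : ℕ} (h0 : S.time n₀ ≤ tO)
    (h1 : tO < S.time (n₀ + 1)) (hn : n₀ ≤ n) (hRf : (S.front R).family = WaveFamily.rho)
    (hom : ∀ n, ∀ f ∈ (S.snap n).fronts, (S.front f).right.w = om (S.idx f))
    (hR : ∀ f, S.InBranch R f → (S.front f).birthPlace = I.J → (S.front f).birthTime ≤ tO) :
    ∃ al, S.Ancestry tO om n₀ R n al := by
  induction n, hn using Nat.le_induction with
  | base => exact ⟨_, .base S h0 h1 hom hRf⟩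
  | succ n hn ih =>
    obtain ⟨al, hal⟩ := ih
    exact hal.step S h1 hn hRf hom hR

end FrontTracking

/-- The variation of a sequence between the indices `m` and `i`. -/
noncomputable def seqVariation (om : ℕ → ℝ) (m i : ℕ) : ℝ :=
  ∑ k ∈ Finset.Ico m i, |om (k + 1) - om k|

theorem abs_sub_le_seqVariation (om : ℕ → ℝ) {m i : ℕ} (h : m ≤ i) :
    |om i - om m| ≤ seqVariation om m i := by
  have := dist_le_Ico_sum_dist om h
  simpa only [seqVariation, Real.dist_eq, abs_sub_comm] using this

theorem seqVariation_add (om : ℕ → ℝ) {m j i : ℕ} (hmj : m ≤ j) (hji : j ≤ i) :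
    seqVariation om m j + seqVariation om j i = seqVariation om m i :=
  Finset.sum_Ico_consecutive _ hmj hji

theorem levelVariation_eq_seqVariation {om om' : ℕ → ℝ} {m i K : ℕ} (hK : i + 1 = m + K)
    (h : ∀ j < K, om' (j + 1) = om (m + j)) : levelVariation om' K = seqVariation om m i := by
  unfold levelVariation seqVariation
  refine (Finset.sum_nbij' (fun k => k + 2 - m) (fun k => k - 2 + m) ?_ ?_ ?_ ?_ ?_).symm
  · intro k hk
    simp only [Finset.mem_Ico, Finset.mem_Icc] at hk ⊢
    omega
  · intro k hk
    simp only [Finset.mem_Ico, Finset.mem_Icc] at hk ⊢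
    omega
  · intro k hk
    simp only [Finset.mem_Ico] at hk
    omega
  · intro k hk
    simp only [Finset.mem_Icc] at hk
    omega
  · intro k hk
    simp only [Finset.mem_Ico] at hk
    obtain ⟨j, rfl⟩ := Nat.exists_eq_add_of_le hk.1
    rw [show m + j + 2 - m = j + 1 + 1 by omega, show j + 1 + 1 - 1 = j + 1 by omega,
      h (j + 1) (by omega), h j (by omega)]
    rfl

/-- The increase of `q` along a chain of `ρ`-waves with decreasing indices is bounded by the
positive variations of `q` across them and the variation of `w`, if `q` is Lipschitz continuous in
`w` along states of equal velocity. -/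
theorem sub_le_of_velChain {M : GSOM} {front : ℕ → WaveFront} {q : TrafficState → ℝ} {c : ℝ}
    (hc : 0 ≤ c) (hq : ∀ U U' : TrafficState, M.Physical U → M.Physical U' → M.vel U = M.vel U' →
      |q U' - q U| ≤ c * |U'.w - U.w|)
    {om : ℕ → ℝ} {idx : ℕ → ℕ} {m j : ℕ} (hmj : m ≤ j) {U' : TrafficState} (hU' : M.Physical U')
    (hw' : U'.w = om j) {s : List ℕ} (hs : s.Pairwise fun f g => idx g ≤ idx f)
    (hwave : ∀ f ∈ s, M.IsWave (front f) ∧ (front f).family = WaveFamily.rho ∧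
      (front f).right.w = om (idx f) ∧ m ≤ idx f)
    {i : ℕ} (hmi : m ≤ i) (hi : ∀ f ∈ s, idx f ≤ i) {U : TrafficState} (hU : M.Physical U)
    (hw : U.w = om i) (hchain : VelChain M front (M.vel U) s (M.vel U')) :
    q U' - q U ≤ c * (seqVariation om m i + seqVariation om m j) +
      (s.map fun f => max (q (front f).right - q (front f).left) 0).sum := by
  induction s generalizing i U with
  | nil =>
    have h1 := (le_abs_self _).trans (hq U U' hU hU' hchain)
    have h2 : |U'.w - U.w| ≤ seqVariation om m i + seqVariation om m j := by
      rw [hw, hw']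
      have h3 := abs_sub_le (om j) (om m) (om i)
      have h4 := abs_sub_le_seqVariation om hmj
      have h5 := abs_sub_le_seqVariation om hmi
      rw [abs_sub_comm] at h5
      linarith
    simpa using h1.trans (mul_le_mul_of_nonneg_left h2 hc)
  | cons f s ih =>
    simp only [List.mem_cons, forall_eq_or_imp] at hwave hi
    obtain ⟨⟨hf, hfr, hfw, hfm⟩, hwave⟩ := hwave
    obtain ⟨hs1, hs2⟩ := List.pairwise_cons.1 hs
    have ih := ih hs2 hwave hfm hs1 hf.physical_right hfw hchain.2
    have h1 := (le_abs_self _).trans (hq U _ hU hf.physical_left hchain.1.symm)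
    have h2 : |(front f).left.w - U.w| ≤ seqVariation om (idx f) i := by
      rw [hf.w_eq hfr, hfw, hw, abs_sub_comm]
      exact abs_sub_le_seqVariation om hi.1
    have h3 := mul_le_mul_of_nonneg_left h2 hc
    have h4 := le_max_left (q (front f).right - q (front f).left) 0
    rw [← seqVariation_add om hfm hi.1, List.map_cons, List.sum_cons]
    linarith

theorem list_sum_le_finset_sum {α : Type*} {s : List α} (hs : s.Nodup) {T : Finset α}
    (hT : ∀ x ∈ s, x ∈ T) {F : α → ℝ} (hF : ∀ x, 0 ≤ F x) : (s.map F).sum ≤ ∑ x ∈ T, F x := by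
  classical
  rw [← List.sum_toFinset F hs]
  exact Finset.sum_le_sum_of_subset_of_nonneg (fun x hx => hT x (List.mem_toFinset.1 hx))
    fun x _ _ => hF x

namespace FrontTracking

variable {M : GSOM} {I : Road} (S : FrontTracking M I)

theorem exists_birthTime_eq {f n : ℕ} (hf : f ∈ (S.snap n).fronts) :
    ∃ m, (S.front f).birthTime = S.time m := by
  induction n with
  | zero => exact ⟨0, by rw [S.birthTime_zero f hf, S.time_zero]⟩
  | succ n ih =>
    by_cases hfn : f ∈ (S.snap n).fronts
    · exact ih hfn
    · refine ⟨n + 1, ?_⟩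
      rcases S.step n with ⟨A, B, l, r, g, hL, hL', hg, hm⟩ |
        ⟨A, B, c, r, g, c', hL, hL', hg, hc', hm⟩ | ⟨N, C, N', hL', hC, hsubset, hnew⟩
      · simp only [hL, hL', List.mem_append, List.mem_cons, not_or] at hf hfn
        obtain rfl : f = g := by tauto
        exact hm.birthTime
      · simp only [hL, hL', List.mem_append, List.mem_cons, not_or] at hf hfn
        have : f = g ∨ f = c' := by tauto
        rcases this with rfl | rfl
        exacts [hm.birthTime, hm.birthTime']
      · simp only [hL', List.mem_append] at hf
        have : f ∉ C := fun h => hfn (hC.subset h)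
        exact (hnew f (by tauto)).2.1

/-- The events that belong to the original time and to the absorption of a returning wave. -/
theorem IsReturningWave.exists_events {R : ℕ} {tO ta : ℝ} (h : S.IsReturningWave R tO ta) :
    ∃ n₀ n₁, n₀ ≤ n₁ ∧ S.time n₀ ≤ tO ∧ tO < S.time (n₀ + 1) ∧ R ∈ (S.snap n₁).fronts := by
  obtain ⟨-, ⟨n₁, hta, hR, -⟩, hlt, ⟨f, hfR, -, hft⟩, -⟩ := h
  have hfmem : ∃ n, f ∈ (S.snap n).fronts := by
    rcases Relation.ReflTransGen.cases_head hfR with rfl | ⟨g, ⟨⟨n, hn, -⟩, -⟩, -⟩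
    exacts [⟨n₁, hR⟩, ⟨n, hn⟩]
  obtain ⟨n, hfn⟩ := hfmem
  obtain ⟨m, hm⟩ := S.exists_birthTime_eq hfn
  rw [hft] at hm
  classical
  have hex : ∃ k, tO < S.time (k + 1) := ⟨n₁, hta ▸ hlt⟩
  refine ⟨Nat.find hex, n₁, Nat.find_min' hex (hta ▸ hlt), ?_, Nat.find_spec hex, hR⟩
  rcases Nat.eq_zero_or_pos (Nat.find hex) with h0 | h0
  · rw [h0, hm]
    exact S.time_mono (Nat.zero_le m)
  · have := Nat.find_min hex (Nat.sub_lt h0 one_pos)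
    rwa [show Nat.find hex - 1 + 1 = Nat.find hex by omega, not_lt] at this

/-- The backward wave tree of a returning wave, seen at its original time. -/
theorem IsReturningWave.exists_representation {R : ℕ} {tO ta : ℝ}
    (h : S.IsReturningWave R tO ta) :
    ∃ n₀ n₁ om s, S.time n₀ ≤ tO ∧ tO < S.time (n₀ + 1) ∧ R ∈ (S.snap n₁).fronts ∧
      (∀ n, ∀ f ∈ (S.snap n).fronts, (S.front f).right.w = om (S.idx f)) ∧
      List.Sublist s (S.snap n₀).fronts ∧ S.Represents tO om R s ∧
      ∀ x ∈ (S.snap n₀).fronts, S.InTree R x → ∃ a ∈ s, S.idx a ≤ S.idx x := by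
  obtain ⟨n₀, n₁, hn, h0, h1, hR⟩ := IsReturningWave.exists_events S h
  obtain ⟨om, hom⟩ := S.exists_wSequence
  obtain ⟨al, hal⟩ := S.exists_ancestry h0 h1 hn h.1 hom
    fun f hf hJ => h.2.2.2.2 ⟨f, hf, hJ, rfl⟩
  refine ⟨n₀, n₁, om, al R, h0, h1, hR, hom, ?_, hal.represents R hR Relation.ReflTransGen.refl,
    fun x hx hRx => hal.self R hR x hx hRx Relation.ReflTransGen.refl⟩
  exact List.Sublist.trans (by simpa using (List.singleton_sublist.2 hR).flatMap al) hal.sublist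

theorem IsReturningWave.exists_isLevelBranch {R K : ℕ} {tO ta : ℝ}
    (h : S.IsReturningWave R tO ta) (hK : S.HasOrder tO R K) :
    ∃ om : ℕ → ℝ, S.IsLevelBranch tO om R K := by
  obtain ⟨n₀, n₁, om, s, h0, h1, hR, hom, hs, hrep, htree⟩ :=
    IsReturningWave.exists_representation S h
  obtain ⟨a, ha, hamin, k, hk, hkl, hkb⟩ := hrep.level
  have hle : k ≤ K := hK.2 ⟨R, Relation.ReflTransGen.refl, hkl⟩
  have hge : K ≤ k := by
    obtain ⟨f, hRf, hf⟩ := hK.1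
    obtain ⟨x, hx, hfx, hKx⟩ := Level.exists_ancestor S h0 h1 hf
    obtain ⟨b, hb, hbx⟩ := htree x hx (Relation.ReflTransGen.trans hfx hRf)
    have h2 := InTree.height_le S hRf
    rw [S.height_rho h.1] at h2
    have h3 := hamin b hb
    omega
  obtain rfl := le_antisymm hle hge
  exact ⟨_, hkb⟩

theorem IsReturningWave.sub_le {R K : ℕ} {tO ta : ℝ} {om' : ℕ → ℝ}
    (h : S.IsReturningWave R tO ta) (hK : S.HasOrder tO R K) (hb : S.IsLevelBranch tO om' R K)
    {q : TrafficState → ℝ} (hq : ∀ U U' : TrafficState, M.Physical U → M.Physical U' →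
      M.vel U = M.vel U' → |q U' - q U| ≤ sSup M.ratios * |U'.w - U.w|) :
    q (S.front R).right - q (S.front R).left ≤ M.Cstar * levelVariation om' K +
      ∑ f ∈ (S.levelOne_finite tO R).toFinset,
        max (q (S.front f).right - q (S.front f).left) 0 := by
  obtain ⟨n₀, n₁, om, s, h0, h1, hR, hom, hs, hrep, htree⟩ :=
    IsReturningWave.exists_representation S h
  obtain ⟨a, ha, hamin, k, hk, hkl, -⟩ := hrep.level
  have hle : k ≤ K := hK.2 ⟨R, Relation.ReflTransGen.refl, hkl⟩
  obtain ⟨x, hx, hxK, hxom⟩ := IsLevelBranch.exists_start S h0 h1 hom hb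
  have hmem : ∀ f ∈ s, f ∈ (S.snap n₀).fronts := fun f hf => hs.subset hf
  have hfam : ∀ f ∈ s, (S.front f).family = WaveFamily.rho := fun f hf =>
    (InBranch.family_eq S (hrep.inBranch f hf)).trans h.1
  have hxs : ∀ f ∈ s, S.idx x ≤ S.idx f := fun f hf => by
    have := hamin f hf
    omega
  have hwR := S.isWave n₁ R hR
  have hxR : S.idx x ≤ S.idx R := (hxs a ha).trans (hrep.idx_le a ha)
  have hmain := sub_le_of_velChain (M := M) (front := S.front) (q := q) (c := sSup M.ratios)
    (by have := M.Cstar_nonneg; unfold GSOM.Cstar at this; linarith) hq (om := om) (idx := S.idx)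
    hxR hwR.physical_right (hom n₁ R hR) ((S.pairwise_idx n₀).sublist hs)
    (fun f hf => ⟨S.isWave n₀ f (hmem f hf), hfam f hf, hom n₀ f (hmem f hf), hxs f hf⟩)
    hxR hrep.idx_le hwR.physical_left ((hwR.w_eq h.1).trans (hom n₁ R hR)) hrep.chain
  have hsum := list_sum_le_finset_sum ((S.nodup n₀).sublist hs)
    (T := (S.levelOne_finite tO R).toFinset)
    (fun f hf => (Set.Finite.mem_toFinset _).2 ⟨InBranch.inTree S (hrep.inBranch f hf), hfam f hf,
      (S.travelsAt_iff h0 h1 f).2 (hmem f hf)⟩)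
    (F := fun f => max (q (S.front f).right - q (S.front f).left) 0) (fun f => le_max_right _ _)
  rw [levelVariation_eq_seqVariation hxK hxom, GSOM.Cstar]
  linarith

end FrontTracking

theorem mainTheorem4 (M : GSOM) :
    (BddAbove M.ratios ∧ 0 ≤ M.Cstar ∧
      ((∃ U, M.Physical U ∧ M.Vw U ≠ 0) → 0 < M.Cstar)) ∧
    ∀ (I : Road) (S : FrontTracking M I) (R : ℕ) (tO ta : ℝ) (K : ℕ),
      S.IsReturningWave R tO ta → S.HasOrder tO R K →
      (∃ om : ℕ → ℝ, S.IsLevelBranch tO om R K) ∧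
      ∀ om : ℕ → ℝ, S.IsLevelBranch tO om R K →
        M.deltaPlus (S.front R) ≤ M.Cstar * levelVariation om K +
          ∑ f ∈ (S.levelOne_finite tO R).toFinset, max (M.deltaPlus (S.front f)) 0 ∧
        M.deltaMinus (S.front R) ≤ M.Cstar * levelVariation om K +
          ∑ f ∈ (S.levelOne_finite tO R).toFinset, max (M.deltaMinus (S.front f)) 0 := by
  refine ⟨⟨M.bddAbove_ratios, M.Cstar_nonneg, fun ⟨U, hU, hne⟩ => M.Cstar_pos hU hne⟩, ?_⟩
  intro I S R tO ta K h hK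
  refine ⟨FrontTracking.IsReturningWave.exists_isLevelBranch S h hK, fun om hb => ⟨?_, ?_⟩⟩
  · exact FrontTracking.IsReturningWave.sub_le S h hK hb (q := M.Q)
      fun U U' hU hU' hvel => M.abs_Q_sub_le hU hU' hvel
  · have hneg : ∀ f : WaveFront, M.deltaMinus f = -M.Q f.right - -M.Q f.left := fun f => by
      unfold GSOM.deltaMinus GSOM.deltaPlus
      ring
    simp only [hneg]
    refine FrontTracking.IsReturningWave.sub_le S h hK hb (q := fun U => -M.Q U)
      fun U U' hU hU' hvel => ?_
    rw [neg_sub_neg, abs_sub_comm]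
    exact M.abs_Q_sub_le hU hU' hvel
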